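/- **Theorem (Lower bound for Q-FK).** There is an absolute constant $c>0$ such that the following holds for all positive integers $k\le m\le n/2$, all $\epsilon\in(0,\tfrac14)$ and all $\delta\in(0,e^{-8}/40)$. Setting. A set $\mathcal S$ of $n$ arms assigns to each arm $a$ a reward law on $[0,1]$ with mean $\mu_a$; different samples, of the same or of different arms, are independent. Let $\lambda_{[m]}$ be the $m$-th largest of the $n$ means (with multiplicity); arm $a$ is $(\epsilon,m)$-optimal if $\mu_a+\epsilon\ge\lambda_{[m]}$. An algorithm is a randomized adaptive procedure: at each step, depending on its internal randomness and on the arms sampled and rewards observed so far, it either takes one more sample of an arm of its choice or stops and returns a set of arms. Its error probability is the probability that it does not stop and return exactly $k$ distinct arms that are all $(\epsilon,m)$-optimal. Claim. There is a set $\mathcal S$ of $n$ arms such that every algorithm whose error probability on $\mathcal S$ is at most $\delta$, however the arms of $\mathcal S$ are numbered, takes in expectation at least $$c\,\frac{k}{\epsilon^2}\Bigl(\frac nm+\log\frac k\delta\Bigr)$$ samples, where the expectation is averaged over the $n!$ numberings of the arms of $\mathcal S$ (in particular, the expected number of samples is at least this large for some numbering). The algorithm may depend on $n,m,k,\epsilon,\delta$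 and on the unnumbered set $\mathcal S$; in particular it may know $\lambda_{[m]}$. -/

import Mathlib

open MeasureTheory

open scoped ENNReal

noncomputable section

namespace QuantileExploration

/-- A set of `n` arms (with a numbering): arm `a` has reward law `ν a`, a probability measure
on `[0,1]`. -/
abbrev ArmSet (n : ℕ) : Type := Fin n → ProbabilityMeasure unitInterval

/-- The same set of arms, numbered differently: number `i` is given to arm `σ i`. -/
def ArmSet.relabel {n : ℕ} (ν : ArmSet n) (σ : Equiv.Perm (Fin n)) : ArmSet n :=
  fun i => ν (σ i)

/-- The expected reward of arm `a`. -/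
def ArmSet.mean {n : ℕ} (ν : ArmSet n) (a : Fin n) : ℝ :=
  ∫ x : unitInterval, (x : ℝ) ∂(ν a : Measure unitInterval)

/-- The `m`-th largest of the numbers `μ 0, …, μ (n - 1)`, counted with multiplicity
(for `1 ≤ m ≤ n`): the greatest `x` such that at least `m` of the numbers are `≥ x`. -/
def mthLargest {n : ℕ} (μ : Fin n → ℝ) (m : ℕ) : ℝ :=
  sSup {x : ℝ | m ≤ (Finset.univ.filter fun a => x ≤ μ a).card}

/-- If `e` lists the arms in order of nonincreasing `μ`, then `mthLargest μ m` is the `m`-th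
entry of that list (here `m = j + 1`, as `Fin n` starts at `0`). -/
theorem mthLargest_eq_of_antitone {n : ℕ} (μ : Fin n → ℝ) (e : Equiv.Perm (Fin n))
    (he : Antitone (μ ∘ e)) (j : Fin n) : mthLargest μ (j + 1) = μ (e j) := by
  refine IsGreatest.csSup_eq ⟨?_, ?_⟩
  · have hsub : (Finset.Iic j).map e.toEmbedding ⊆
        Finset.univ.filter fun a => μ (e j) ≤ μ a := by
      intro a ha
      obtain ⟨i, hi, rfl⟩ := Finset.mem_map.1 ha
      simpa using he (Finset.mem_Iic.1 hi)
    have := Finset.card_le_card hsub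
    simpa using this
  · intro x hx
    by_contra! hlt
    have hsub : (Finset.univ.filter fun a => x ≤ μ a) ⊆
        (Finset.Iio j).map e.toEmbedding := by
      intro a ha
      have hxa : x ≤ μ a := by simpa using ha
      refine Finset.mem_map.2 ⟨e.symm a, Finset.mem_Iio.2 ?_, by simp⟩
      by_contra! hle
      have h1 : μ (e (e.symm a)) ≤ μ (e j) := he hle
      rw [Equiv.apply_symm_apply] at h1
      linarith
    have h2 := Finset.card_le_card hsub
    have h3 : (j : ℕ) + 1 ≤ (Finset.univ.filter fun a => x ≤ μ a).card := hx
    simp at h2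
    omega

/-- Arm `a` is `(ε, m)`-optimal: `μ_a + ε ≥ λ_[m]`. -/
def ArmSet.IsOptimal {n : ℕ} (ν : ArmSet n) (ε : ℝ) (m : ℕ) (a : Fin n) : Prop :=
  mthLargest ν.mean m ≤ ν.mean a + ε

/-- What was observed in the first `t` samples: for each of them, the arm and its reward. -/
abbrev History (n t : ℕ) : Type := Fin t → Fin n × unitInterval

/-- How many of the `t` samples recorded in `h` were taken from arm `a`. -/
def History.count {n t : ℕ} (h : History n t) (a : Fin n) : ℕ :=
  (Finset.univ.filter fun s => (h s).1 = a).card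

/-- The next move of an algorithm: take one sample of an arm, or stop and return a set of
arms. -/
inductive Move (n : ℕ) : Type
  | sample (a : Fin n)
  | halt (answer : Finset (Fin n))

/-- A randomized adaptive algorithm for `n` arms: its next move is a measurable function of its
internal randomness and of all that it has observed so far. -/
structure Algorithm (n : ℕ) where
  /-- the sample space of the internal randomness -/
  Seed : Type
  /-- its measurable sets -/
  seedSpace : MeasurableSpace Seed
  /-- the law of the internal randomness -/
  seedLaw : ProbabilityMeasure Seed
  /-- the move after `t` samples -/
  move : (t : ℕ) → Seed × History n t → Move n
  measurableSet_move : ∀ (t : ℕ) (y : Move n), MeasurableSet {p | move t p = y}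

namespace Algorithm

variable {n : ℕ}

attribute [instance] Algorithm.seedSpace

/-- The rewards: `R (a, j)` is the reward of the sample number `j` of arm `a`
(`j = 0, 1, 2, …`). -/
abbrev Rewards (n : ℕ) : Type := Fin n × ℕ → unitInterval

/-- What the algorithm `A`, run with the given internal randomness and rewards, has observed when
it has taken `t` samples; `none` if it stops before. -/
def history (A : Algorithm n) (s : A.Seed) (R : Rewards n) : (t : ℕ) → Option (History n t)
  | 0 => some Fin.elim0
  | t + 1 =>
    match A.history s R t with
    | none => none
    | some h =>
      match A.move t (s, h) with
      | Move.sample a => some (Fin.snoc h (a, R (a, h.count a)))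
      | Move.halt _ => none

/-- The algorithm stops at some time and returns `S`. -/
def Returns (A : Algorithm n) (s : A.Seed) (R : Rewards n) (S : Finset (Fin n)) : Prop :=
  ∃ (t : ℕ) (h : History n t), A.history s R t = some h ∧ A.move t (s, h) = Move.halt S

/-- The number of samples taken, possibly infinite: `1` for each `t` such that sample number
`t + 1` is taken. -/
def numSamples (A : Algorithm n) (s : A.Seed) (R : Rewards n) : ℝ≥0∞ :=
  ∑' t : ℕ, if (A.history s R (t + 1)).isSome then 1 else 0

/-- The joint law of the internal randomness and the rewards when `A` is run on `ν`: the rewards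
are independent across samples and arms and independent of the internal randomness, and each
reward of arm `a` has law `ν a`. -/
def law (A : Algorithm n) (ν : ArmSet n) : Measure (A.Seed × Rewards n) :=
  (A.seedLaw : Measure A.Seed).prod
    (Measure.infinitePi fun p : Fin n × ℕ => (ν p.1 : Measure unitInterval))

/-- The probability that `A`, run on `ν`, fails to stop and return exactly `k` distinct arms, all
of them `(ε, m)`-optimal. -/
def errorProb (A : Algorithm n) (ν : ArmSet n) (k m : ℕ) (ε : ℝ) : ℝ≥0∞ :=
  A.law ν {p | ¬ ∃ S : Finset (Fin n),
    A.Returns p.1 p.2 S ∧ S.card = k ∧ ∀ a ∈ S, ν.IsOptimal ε m a}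

/-- The expected number of samples that `A` takes on `ν`. -/
def expectedSamples (A : Algorithm n) (ν : ArmSet n) : ℝ≥0∞ :=
  ∫⁻ p, A.numSamples p.1 p.2 ∂(A.law ν)

end Algorithm

end QuantileExploration

end

/-!
The hard instance has `m` good arms with Bernoulli rewards of mean `1 / 2 + ε` and `n - m` bad arms
of mean `1 / 2 - ε`. Averaging over the numberings means averaging over the set `G` of good arms,
and the algorithm has to return `k` arms of `G`. With the seed fixed and the run cut off after
`N` samples, about four times the claimed bound, the algorithm becomes a finite decision tree. The
score of an arm is its log-likelihood ratio, good against bad. The probability of a leaf under `G`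
is its probability with all arms bad times the exponential of the sum over `G` of the scores, so all
`G` can be compared leaf by leaf.

*Confidence* (`k * log (k / δ) / ε²`, `DecisionTree.confidence_bound`). The sum over all arms of
`√(1 + score²) - 1` grows by at most `30 * ε²` per sample in expectation, for every `G`. So if few
samples are taken, then at least half of the arms of a correct answer and half of the arms outside
`G` have small scores. Exchanging one of the former for one of the latter keeps the likelihood up to
a factor `exp (O (ε² * B / k))`, where `B` is the expected number of samples, and makes the answer
wrong. Each set obtained in this way misses exactly one arm of the answer, hence exchanges at different arms do not overlap, and about `k` times as much
probability of error is obtained as from a single arm: this is the `k` inside the logarithm.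

*Search* (`k * n / (m * ε²)`, `DecisionTree.search_bound`). A good arm is returned with probability
about `k / m` on average. Under `H = G \ {b}` an average arm `b` outside `H` is returned with
probability at most about `k / n`, and making it good can raise this, beyond a constant factor, only
by a multiple of the expectation of `exp (score) - 1 - score`, which is the Kullback-Leibler
divergence of the rewards seen from `b`; these add up to `O (ε² * N)` over all `b`.

The passage from decision trees to the probability space of the algorithm
(`Algorithm.rewardLaw_mul_tree_le`) only needs lower bounds for the error probability and the
expected number of samples.
-/

noncomputable section

namespace QuantileExploration

/-! ### Decision trees and change of measure -/

/-- A deterministic adaptive procedure with binary rewards and boundedly many samples. At a node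
an arm is sampled and the reward bit selects the subtree; at a leaf the procedure has either
answered (`some S`) or been cut off before it stopped (`none`). -/
inductive DecisionTree (n : ℕ) : Type
  | leaf (answer : Option (Finset (Fin n)))
  | node (a : Fin n) (next : Bool → DecisionTree n)

/-- The probability that the reward bit of arm `a` is `b` when `G` is the set of good arms: good
arms have success probability `1 / 2 + ε`, the others `1 / 2 - ε`. -/
def rewardProb {n : ℕ} (ε : ℝ) (G : Finset (Fin n)) (a : Fin n) (b : Bool) : ℝ :=
  if (a ∈ G ↔ b = true) then 1 / 2 + ε else 1 / 2 - ε

/-- The logarithm of the likelihood ratio of the reward bit `b`, good arm against bad arm. As the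
two laws are mirror images of each other, the two bits have opposite values. -/
def logRatio (ε : ℝ) (b : Bool) : ℝ :=
  if b then Real.log ((1 / 2 + ε) / (1 / 2 - ε)) else -Real.log ((1 / 2 + ε) / (1 / 2 - ε))

namespace DecisionTree

variable {n : ℕ}

/-- The expectation, when `G` is the set of good arms, of `F answer x` at the leaf that is reached.
The score `x a` is the log-likelihood ratio (good against bad) of all rewards seen from arm `a`; the
second argument is the score at the root. -/
def expect (ε : ℝ) (G : Finset (Fin n)) (F : Option (Finset (Fin n)) → (Fin n → ℝ) → ℝ) :
    DecisionTree n → (Fin n → ℝ) → ℝ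
  | leaf o, x => F o x
  | node a next, x =>
    ∑ b, rewardProb ε G a b * (next b).expect ε G F (x + Pi.single a (logRatio ε b))

/-- The expected number of samples taken when `G` is the set of good arms. -/
def draws (ε : ℝ) (G : Finset (Fin n)) : DecisionTree n → ℝ
  | leaf _ => 0
  | node a next => 1 + ∑ b, rewardProb ε G a b * (next b).draws ε G

/-- The largest possible number of samples. -/
def depth : DecisionTree n → ℕ
  | leaf _ => 0
  | node _ next => 1 + max (next true).depth (next false).depth

end DecisionTree

theorem rewardProb_nonneg {n : ℕ} {ε : ℝ} (h0 : 0 < ε) (h1 : ε < 1 / 4) (G : Finset (Fin n))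
    (a : Fin n) (b : Bool) : 0 ≤ rewardProb ε G a b := by
  unfold rewardProb; split_ifs <;> linarith

theorem sum_rewardProb {n : ℕ} (ε : ℝ) (G : Finset (Fin n)) (a : Fin n) :
    ∑ b, rewardProb ε G a b = 1 := by
  by_cases h : a ∈ G <;> simp [rewardProb, h] <;> ring

theorem rewardProb_eq_exp {n : ℕ} {ε : ℝ} (h0 : 0 < ε) (h1 : ε < 1 / 4) (G : Finset (Fin n))
    (a : Fin n) (b : Bool) :
    rewardProb ε G a b
      = rewardProb ε ∅ a b * Real.exp (∑ i ∈ G, (Pi.single a (logRatio ε b) : Fin n → ℝ) i) := by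
  have hp : 0 < (1 / 2 + ε) / (1 / 2 - ε) := div_pos (by linarith) (by linarith)
  have hq : (1 / 2 - ε) ≠ 0 := by linarith
  have hp' : (1 / 2 + ε) ≠ 0 := by linarith
  have hq' : 1 - 2 * ε ≠ 0 := by linarith
  rw [Finset.sum_pi_single']
  by_cases h : a ∈ G <;> cases b <;>
    simp only [rewardProb, logRatio, h, Real.exp_neg, Real.exp_log hp, if_true, if_false,
      Real.exp_zero, mul_one, Finset.notMem_empty, Bool.false_eq_true, iff_true, iff_false,
      not_true, iff_self] <;> field_simp

theorem logRatio_true_nonneg {ε : ℝ} (h0 : 0 < ε) (h1 : ε < 1 / 4) : 0 ≤ logRatio ε true := by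
  simp only [logRatio, if_true]
  apply Real.log_nonneg
  rw [le_div_iff₀ (by linarith)]; linarith

theorem logRatio_true_le {ε : ℝ} (h0 : 0 < ε) (h1 : ε < 1 / 4) : logRatio ε true ≤ 6 * ε := by
  have hq : (0 : ℝ) < 1 - 2 * ε := by linarith
  have hp : (0 : ℝ) < 1 + 2 * ε := by linarith
  have e1 : (1 / 2 + ε) / (1 / 2 - ε) = (1 + 2 * ε) / (1 - 2 * ε) := by
    rw [div_eq_div_iff (by linarith) (by linarith)]; ring
  have h2 := Real.log_le_sub_one_of_pos hp
  have h3 := Real.one_sub_inv_le_log_of_pos hq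
  have h4 : (1 - 2 * ε)⁻¹ ≤ 1 + 4 * ε := by
    rw [inv_le_comm₀ hq (by linarith), inv_le_iff_one_le_mul₀ (by linarith)]
    nlinarith
  simp only [logRatio, if_true, e1, Real.log_div hp.ne' hq.ne']
  linarith

theorem logRatio_false (ε : ℝ) : logRatio ε false = -logRatio ε true := by
  simp [logRatio]

namespace DecisionTree

variable {n : ℕ} {ε : ℝ} {G : Finset (Fin n)}
  {F F' : Option (Finset (Fin n)) → (Fin n → ℝ) → ℝ}

theorem expect_mono (h0 : 0 < ε) (h1 : ε < 1 / 4) (hF : ∀ o x, F o x ≤ F' o x)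
    (T : DecisionTree n) (x : Fin n → ℝ) : T.expect ε G F x ≤ T.expect ε G F' x := by
  induction T generalizing x with
  | leaf o => exact hF o x
  | node a next ih =>
    exact Finset.sum_le_sum fun b _ =>
      mul_le_mul_of_nonneg_left (ih b _) (rewardProb_nonneg h0 h1 G a b)

theorem expect_const (c : ℝ) (T : DecisionTree n) (x : Fin n → ℝ) :
    T.expect ε G (fun _ _ => c) x = c := by
  induction T generalizing x with
  | leaf o => rfl
  | node a next ih =>
    simp only [expect, ih]
    rw [← Finset.sum_mul, sum_rewardProb, one_mul]

theorem expect_nonneg (h0 : 0 < ε) (h1 : ε < 1 / 4) (hF : ∀ o x, 0 ≤ F o x)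
    (T : DecisionTree n) (x : Fin n → ℝ) : 0 ≤ T.expect ε G F x := by
  have := expect_mono (G := G) h0 h1 hF T x
  rwa [expect_const] at this

theorem expect_add (T : DecisionTree n) (x : Fin n → ℝ) :
    T.expect ε G (fun o y => F o y + F' o y) x = T.expect ε G F x + T.expect ε G F' x := by
  induction T generalizing x with
  | leaf o => rfl
  | node a next ih => simp only [expect, ih, mul_add, Finset.sum_add_distrib]

theorem expect_const_mul (c : ℝ) (T : DecisionTree n) (x : Fin n → ℝ) :
    T.expect ε G (fun o y => c * F o y) x = c * T.expect ε G F x := by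
  induction T generalizing x with
  | leaf o => rfl
  | node a next ih =>
    simp only [expect, ih, Finset.mul_sum]
    exact Finset.sum_congr rfl fun b _ => by ring

theorem expect_sum {ι : Type*} (s : Finset ι)
    (F : ι → Option (Finset (Fin n)) → (Fin n → ℝ) → ℝ) (T : DecisionTree n) (x : Fin n → ℝ) :
    T.expect ε G (fun o y => ∑ i ∈ s, F i o y) x = ∑ i ∈ s, T.expect ε G (F i) x := by
  classical
  induction s using Finset.induction_on with
  | empty => simpa using expect_const 0 T x
  | insert i s hi ih => simp only [Finset.sum_insert hi, expect_add, ih]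

/-- Change of measure: making the arms of `G` good multiplies the probability of a leaf with score
`x` by `exp (∑ i ∈ G, x i)`. -/
theorem exp_mul_expect (h0 : 0 < ε) (h1 : ε < 1 / 4) (T : DecisionTree n) (x : Fin n → ℝ) :
    Real.exp (∑ i ∈ G, x i) * T.expect ε G F x
      = T.expect ε ∅ (fun o y => Real.exp (∑ i ∈ G, y i) * F o y) x := by
  induction T generalizing x with
  | leaf o => rfl
  | node a next ih =>
    simp only [expect, Finset.mul_sum]
    refine Finset.sum_congr rfl fun b _ => ?_
    rw [← ih b, rewardProb_eq_exp h0 h1 G]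
    simp only [Pi.add_apply, Finset.sum_add_distrib, Real.exp_add]
    ring

theorem expect_eq_expect_empty (h0 : 0 < ε) (h1 : ε < 1 / 4) (T : DecisionTree n) :
    T.expect ε G F 0 = T.expect ε ∅ (fun o y => Real.exp (∑ i ∈ G, y i) * F o y) 0 := by
  rw [← exp_mul_expect h0 h1]; simp

theorem expect_insert (h0 : 0 < ε) (h1 : ε < 1 / 4) {b : Fin n} (hb : b ∉ G)
    (T : DecisionTree n) :
    T.expect ε (insert b G) F 0 = T.expect ε G (fun o y => Real.exp (y b) * F o y) 0 := by
  rw [expect_eq_expect_empty h0 h1, expect_eq_expect_empty h0 h1 (G := G)]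
  congr 1
  funext o y
  rw [Finset.sum_insert hb, Real.exp_add]
  ring

theorem draws_nonneg (h0 : 0 < ε) (h1 : ε < 1 / 4) (T : DecisionTree n) :
    0 ≤ T.draws ε G := by
  induction T with
  | leaf o => exact le_rfl
  | node a next ih =>
    exact add_nonneg zero_le_one
      (Finset.sum_nonneg fun b _ => mul_nonneg (rewardProb_nonneg h0 h1 G a b) (ih b))

theorem draws_le_depth (h0 : 0 < ε) (h1 : ε < 1 / 4) (T : DecisionTree n) :
    T.draws ε G ≤ T.depth := by
  induction T with
  | leaf o => simp [draws, depth]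
  | node a next ih =>
    have h : ∑ b, rewardProb ε G a b * (next b).draws ε G
        ≤ ∑ b, rewardProb ε G a b * (max (next true).depth (next false).depth : ℕ) := by
      refine Finset.sum_le_sum fun b _ =>
        mul_le_mul_of_nonneg_left ((ih b).trans ?_) (rewardProb_nonneg h0 h1 G a b)
      cases b <;> simp
    rw [← Finset.sum_mul, sum_rewardProb, one_mul] at h
    simp only [draws, depth]
    push_cast at h ⊢
    linarith

/-- A potential of the scores that grows by at most `κ` in expectation at each sample has grown by
at most `κ` times the expected number of samples at the end. -/
theorem expect_le_add_draws (h0 : 0 < ε) (h1 : ε < 1 / 4) {Φ : (Fin n → ℝ) → ℝ} {κ : ℝ}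
    (hΦ : ∀ a x, ∑ b, rewardProb ε G a b * Φ (x + Pi.single a (logRatio ε b)) ≤ Φ x + κ)
    (T : DecisionTree n) (x : Fin n → ℝ) :
    T.expect ε G (fun _ y => Φ y) x ≤ Φ x + κ * T.draws ε G := by
  induction T generalizing x with
  | leaf o => simp [expect, draws]
  | node a next ih =>
    have h : (node a next).expect ε G (fun _ y => Φ y) x ≤ ∑ b, rewardProb ε G a b *
        (Φ (x + Pi.single a (logRatio ε b)) + κ * (next b).draws ε G) :=
      Finset.sum_le_sum fun b _ =>
        mul_le_mul_of_nonneg_left (ih b _) (rewardProb_nonneg h0 h1 G a b)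
    have h2 : ∑ b, rewardProb ε G a b *
        (Φ (x + Pi.single a (logRatio ε b)) + κ * (next b).draws ε G)
        = ∑ b, rewardProb ε G a b * Φ (x + Pi.single a (logRatio ε b))
          + κ * ∑ b, rewardProb ε G a b * (next b).draws ε G := by
      rw [Finset.mul_sum, ← Finset.sum_add_distrib]
      exact Finset.sum_congr rfl fun b _ => by ring
    have h3 := hΦ a x
    simp only [draws]
    linarith

/-- A sample changes the score of one arm only, so a sum over arms of one-arm potentials has the
drift of a single one. -/
theorem drift_sum (s : Finset (Fin n)) (φ : ℝ → ℝ) {κ : ℝ} (hκ : 0 ≤ κ)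
    (hφ : ∀ a ∈ s, ∀ u, ∑ b, rewardProb ε G a b * φ (u + logRatio ε b) ≤ φ u + κ)
    (a : Fin n) (x : Fin n → ℝ) :
    ∑ b, rewardProb ε G a b * ∑ i ∈ s, φ ((x + Pi.single a (logRatio ε b) : Fin n → ℝ) i)
      ≤ ∑ i ∈ s, φ (x i) + κ := by
  simp only [Finset.mul_sum]
  rw [Finset.sum_comm]
  have key : ∀ i ∈ s, ∑ b, rewardProb ε G a b * φ ((x + Pi.single a (logRatio ε b) : Fin n → ℝ) i)
      ≤ φ (x i) + if i = a then κ else 0 := by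
    intro i hi
    by_cases h : i = a
    · subst h; simpa using hφ i hi (x i)
    · simp only [Pi.add_apply, Pi.single_eq_of_ne h, add_zero, h, if_false]
      rw [← Finset.sum_mul, sum_rewardProb, one_mul]
  refine (Finset.sum_le_sum key).trans ?_
  rw [Finset.sum_add_distrib, Finset.sum_ite_eq']
  split_ifs <;> linarith

end DecisionTree

/-- The potential `√(1 + u²) - 1` is comparable to `|u|` for large `u`, has bounded derivative and
is quadratic at `0`; hence its drift is of order `ε²`, whether the arm is good or bad. -/
theorem sqrt_drift {n : ℕ} {ε : ℝ} (h0 : 0 < ε) (h1 : ε < 1 / 4) (G : Finset (Fin n))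
    (a : Fin n) (u : ℝ) :
    ∑ b, rewardProb ε G a b * (√(1 + (u + logRatio ε b) ^ 2) - 1)
      ≤ √(1 + u ^ 2) - 1 + 30 * ε ^ 2 := by
  set s := √(1 + u ^ 2) with hs
  have hs2 : s ^ 2 = 1 + u ^ 2 := Real.sq_sqrt (by positivity)
  have hs1 : 1 ≤ s := Real.one_le_sqrt.2 (by nlinarith [sq_nonneg u])
  have hus : |u| ≤ s := Real.abs_le_sqrt (by linarith)
  -- the square root lies below its tangent at `1 + u ^ 2`
  have tangent : ∀ ξ : ℝ, √(1 + (u + ξ) ^ 2) ≤ s + (2 * u * ξ + ξ ^ 2) / (2 * s) := by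
    intro ξ
    have h := Real.sq_sqrt (show 0 ≤ 1 + (u + ξ) ^ 2 by positivity)
    have : s + (2 * u * ξ + ξ ^ 2) / (2 * s)
        = (s ^ 2 + √(1 + (u + ξ) ^ 2) ^ 2) / (2 * s) := by
      rw [h]; field_simp; nlinarith
    rw [this, le_div_iff₀ (by linarith)]
    nlinarith [sq_nonneg (s - √(1 + (u + ξ) ^ 2))]
  set l := logRatio ε true with hl
  have hl0 : 0 ≤ l := logRatio_true_nonneg h0 h1
  have hl6 : l ≤ 6 * ε := logRatio_true_le h0 h1
  have ht := tangent l
  have hf := tangent (-l)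
  have hA : -1 ≤ u / s ∧ u / s ≤ 1 := by
    rw [le_div_iff₀ (by linarith), div_le_iff₀ (by linarith)]
    exact ⟨by linarith [neg_le_of_abs_le hus], by linarith [le_of_abs_le hus]⟩
  have hB : l ^ 2 / (2 * s) ≤ 18 * ε ^ 2 := by
    rw [div_le_iff₀ (by linarith)]
    nlinarith [mul_nonneg h0.le (sub_nonneg.2 hs1)]
  have hC : ε * l ≤ 6 * ε ^ 2 := by nlinarith
  have e1 : (2 * u * l + l ^ 2) / (2 * s) = u / s * l + l ^ 2 / (2 * s) := by
    field_simp
  have e2 : (2 * u * -l + (-l) ^ 2) / (2 * s) = - (u / s * l) + l ^ 2 / (2 * s) := by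
    field_simp
  rw [e1] at ht
  rw [e2] at hf
  have hel : 0 ≤ ε * l := by positivity
  rw [Fintype.sum_bool, logRatio_false, ← hl]
  by_cases h : a ∈ G
  · simp only [rewardProb, h, if_true, iff_false, Bool.false_eq_true, not_true, if_false]
    nlinarith [mul_le_mul_of_nonneg_left ht (show (0:ℝ) ≤ 1 / 2 + ε by linarith),
      mul_le_mul_of_nonneg_left hf (show (0:ℝ) ≤ 1 / 2 - ε by linarith), hA.1, hA.2]
  · simp only [rewardProb, h, if_true, iff_true, Bool.false_eq_true, if_false]
    nlinarith [mul_le_mul_of_nonneg_left ht (show (0:ℝ) ≤ 1 / 2 - ε by linarith),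
      mul_le_mul_of_nonneg_left hf (show (0:ℝ) ≤ 1 / 2 + ε by linarith), hA.1, hA.2]

/-- On a bad arm the likelihood ratio `exp u` is a martingale, so the drift of `exp u - 1 - u` is
the Kullback-Leibler divergence of the two reward laws. -/
theorem exp_drift {n : ℕ} {ε : ℝ} (h0 : 0 < ε) (h1 : ε < 1 / 4) {G : Finset (Fin n)}
    {a : Fin n} (ha : a ∉ G) (u : ℝ) :
    ∑ b, rewardProb ε G a b * (Real.exp (u + logRatio ε b) - 1 - (u + logRatio ε b))
      ≤ Real.exp u - 1 - u + 12 * ε ^ 2 := by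
  have hp : 0 < (1 / 2 + ε) / (1 / 2 - ε) := div_pos (by linarith) (by linarith)
  have hl6 := logRatio_true_le h0 h1
  have hq : (1 / 2 - ε) ≠ 0 := by linarith
  have hp' : (1 / 2 + ε) ≠ 0 := by linarith
  have et : Real.exp (logRatio ε true) = (1 / 2 + ε) / (1 / 2 - ε) := by
    rw [logRatio, if_pos rfl, Real.exp_log hp]
  rw [Fintype.sum_bool, logRatio_false, Real.exp_add, Real.exp_add, Real.exp_neg, et]
  simp only [rewardProb, ha, Bool.false_eq_true, if_true, if_false, false_iff, not_true]
  have e1 : (1 / 2 - ε) * (Real.exp u * ((1 / 2 + ε) / (1 / 2 - ε)))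
      + (1 / 2 + ε) * (Real.exp u * ((1 / 2 + ε) / (1 / 2 - ε))⁻¹) = Real.exp u := by
    rw [inv_div]
    have h2 : (1 / 2 - ε) * ((1 / 2 + ε) / (1 / 2 - ε)) = 1 / 2 + ε := mul_div_cancel₀ _ hq
    have h3 : (1 / 2 + ε) * ((1 / 2 - ε) / (1 / 2 + ε)) = 1 / 2 - ε := mul_div_cancel₀ _ hp'
    linear_combination Real.exp u * h2 + Real.exp u * h3
  nlinarith

/-! ### Lower bounds for decision trees -/

/-- Exchanging an element `a` of `S ⊆ G` for an element `b` outside `G` gives a set that misses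
exactly the element `a` of `S`. Hence `G`, `a` and `b` can be recovered from the new set and `b`,
and each set is produced at most `m` times. -/
theorem sum_sum_sum_swap_le {α : Type*} [Fintype α] [DecidableEq α] (S : Finset α) (m : ℕ)
    (f : Finset α → ℝ) (hf : ∀ G, 0 ≤ f G) :
    ∑ G ∈ (Finset.univ : Finset α).powersetCard m with S ⊆ G,
        ∑ a ∈ S, ∑ b ∈ Gᶜ, f (insert b (G.erase a))
      ≤ m * ∑ G ∈ (Finset.univ : Finset α).powersetCard m with ¬ S ⊆ G, f G := by
  have hR : m * ∑ G ∈ (Finset.univ : Finset α).powersetCard m with ¬ S ⊆ G, f G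
      = ∑ p ∈ (((Finset.univ : Finset α).powersetCard m).filter fun G => ¬ S ⊆ G).sigma
          (fun G : Finset α => G), f p.1 := by
    rw [Finset.sum_sigma, Finset.mul_sum]
    refine Finset.sum_congr rfl fun G hG => ?_
    simp only [Finset.sum_const, nsmul_eq_mul,
      (Finset.mem_powersetCard.1 (Finset.mem_filter.1 hG).1).2]
  have hL : ∑ G ∈ (Finset.univ : Finset α).powersetCard m with S ⊆ G,
        ∑ a ∈ S, ∑ b ∈ Gᶜ, f (insert b (G.erase a))
      = ∑ q ∈ (((Finset.univ : Finset α).powersetCard m).filter fun G => S ⊆ G).sigma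
          (fun G : Finset α => S ×ˢ Gᶜ), f (insert q.2.2 (q.1.erase q.2.1)) := by
    rw [Finset.sum_sigma]
    exact Finset.sum_congr rfl fun G _ => by rw [Finset.sum_product]
  rw [hL, hR]
  set g : (Σ _ : Finset α, α × α) → (Σ _ : Finset α, α) :=
    fun q => ⟨insert q.2.2 (q.1.erase q.2.1), q.2.2⟩ with hg
  set D := (((Finset.univ : Finset α).powersetCard m).filter fun G => S ⊆ G).sigma
          (fun G : Finset α => S ×ˢ Gᶜ) with hD
  have hmem : ∀ q ∈ D, q.1.card = m ∧ S ⊆ q.1 ∧ q.2.1 ∈ S ∧ q.2.2 ∉ q.1 := by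
    rintro ⟨G, a, b⟩ hq
    simpa [hD, and_assoc] using hq
  have hinj : Set.InjOn g D := by
    rintro ⟨G, a, b⟩ hq ⟨G', a', b'⟩ hq' h
    obtain ⟨-, h1, h2, h3⟩ := hmem _ hq
    obtain ⟨-, h1', h2', h3'⟩ := hmem _ hq'
    simp only [hg, Sigma.mk.injEq, heq_eq_eq] at h h1 h2 h3 h1' h2' h3'
    obtain ⟨h, rfl⟩ := h
    have hG : ∀ {x : α} {K : Finset α}, b ∉ K → (insert b (K.erase x)).erase b = K.erase x :=
      fun {x K} hb => Finset.erase_insert fun h => hb (Finset.mem_of_mem_erase h)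
    have he : G.erase a = G'.erase a' := by rw [← hG h3, ← hG h3', h]
    have haa : a = a' := by
      by_contra hne
      have h4 : a ∈ G'.erase a' := Finset.mem_erase.2 ⟨hne, h1' h2⟩
      rw [← he] at h4
      exact Finset.notMem_erase a G h4
    subst haa
    have : G = G' := by
      rw [← Finset.insert_erase (h1 h2), he, Finset.insert_erase (h1' h2')]
    subst this
    rfl
  calc ∑ q ∈ D, f (insert q.2.2 (q.1.erase q.2.1)) = ∑ p ∈ D.image g, f p.1 := by
        rw [Finset.sum_image hinj]
    _ ≤ _ := by
        refine Finset.sum_le_sum_of_subset_of_nonneg ?_ fun p _ _ => hf _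
        intro p hp
        obtain ⟨⟨G, a, b⟩, hq, rfl⟩ := Finset.mem_image.1 hp
        obtain ⟨h0, h1, h2, h3⟩ := hmem _ hq
        simp only at h0 h1 h2 h3
        have hb : b ∉ G.erase a := fun h => h3 (Finset.mem_of_mem_erase h)
        refine Finset.mem_sigma.2 ⟨Finset.mem_filter.2
          ⟨Finset.mem_powersetCard.2 ⟨Finset.subset_univ _, ?_⟩, fun hS => ?_⟩,
          Finset.mem_insert_self _ _⟩
        · rw [Finset.card_insert_of_notMem hb, Finset.card_erase_add_one (h1 h2), h0]
        · rcases Finset.mem_insert.1 (hS h2) with h | h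
          · exact h3 ((show a = b from h) ▸ h1 h2)
          · exact Finset.notMem_erase a G h

theorem sum_erase_eq_sum_insert {α : Type*} [Fintype α] [DecidableEq α] (m : ℕ)
    (f : Finset α → α → ℝ) :
    ∑ G ∈ (Finset.univ : Finset α).powersetCard (m + 1), ∑ b ∈ G, f G b
      = ∑ H ∈ (Finset.univ : Finset α).powersetCard m, ∑ b ∈ Hᶜ, f (insert b H) b := by
  rw [Finset.sum_sigma', Finset.sum_sigma']
  refine Finset.sum_bij' (fun p _ => ⟨p.1.erase p.2, p.2⟩) (fun p _ => ⟨insert p.2 p.1, p.2⟩)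
    ?_ ?_ ?_ ?_ ?_
  · rintro ⟨G, b⟩ h
    simp only [Finset.mem_sigma, Finset.mem_powersetCard_univ] at h
    simp [Finset.card_erase_of_mem h.2, h.1]
  · rintro ⟨H, b⟩ h
    simp only [Finset.mem_sigma, Finset.mem_powersetCard_univ, Finset.mem_compl] at h
    simp [Finset.card_insert_of_notMem h.2, h.1]
  · rintro ⟨G, b⟩ h
    simp only [Finset.mem_sigma] at h
    simp [Finset.insert_erase h.2]
  · rintro ⟨H, b⟩ h
    simp only [Finset.mem_sigma, Finset.mem_compl] at h
    simp [Finset.erase_insert h.2]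
  · rintro ⟨G, b⟩ h
    simp only [Finset.mem_sigma] at h
    simp [Finset.insert_erase h.2]

/-- The leafwise form of the confidence lower bound. If the total potential of the scores is at most
`M`, then all but `k / 2` arms have a score of absolute value at most `2 * M / k + 1`. Exchanging
such an arm of the answer `S` for such an arm outside `G` changes the likelihood by a factor of
at most `exp (2 * (2 * M / k + 1))` and turns `S` into a wrong answer; each `G` allows
`(k / 2) * (m / 2)` exchanges, and each result arises at most `m` times. -/
theorem sum_exp_subset_le {n m k : ℕ} (hk : 1 ≤ k) (hkm : k ≤ m) (hmn : 2 * m ≤ n)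
    {S : Finset (Fin n)} (hS : S.card = k) (x : Fin n → ℝ) {M : ℝ} (hM : 0 < M)
    (hx : ∑ i, (√(1 + x i ^ 2) - 1) ≤ M) :
    (k : ℝ) / 4 * Real.exp (-(2 * (2 * M / k + 1)))
        * ∑ G ∈ (Finset.univ : Finset (Fin n)).powersetCard m with S ⊆ G,
            Real.exp (∑ i ∈ G, x i)
      ≤ ∑ G ∈ (Finset.univ : Finset (Fin n)).powersetCard m with ¬ S ⊆ G,
            Real.exp (∑ i ∈ G, x i) := by
  have hk0 : (0 : ℝ) < k := by exact_mod_cast hk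
  have hm0 : (0 : ℝ) < m := hk0.trans_le (by exact_mod_cast hkm)
  set β := 2 * M / k with hβ
  have hβ0 : 0 < β := by positivity
  set φ : ℝ → ℝ := fun u => √(1 + u ^ 2) - 1 with hφ
  have hφ0 : ∀ u, 0 ≤ φ u := fun u =>
    sub_nonneg.2 (Real.one_le_sqrt.2 (by nlinarith [sq_nonneg u]))
  have hφu : ∀ u, |u| ≤ φ u + 1 := fun u => by
    simp only [hφ, sub_add_cancel]
    exact Real.abs_le_sqrt (by linarith)
  -- the arms of large score, at most `k / 2` of them by Markov's inequality
  set B := Finset.univ.filter fun i => β < φ (x i) with hB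
  have hBcard : (B.card : ℝ) ≤ k / 2 := by
    have h1 : B.card * β ≤ ∑ i ∈ B, φ (x i) := by
      rw [← nsmul_eq_mul]
      exact Finset.card_nsmul_le_sum _ _ _ fun i hi => (Finset.mem_filter.1 hi).2.le
    have h2 : ∑ i ∈ B, φ (x i) ≤ ∑ i, φ (x i) :=
      Finset.sum_le_sum_of_subset_of_nonneg (Finset.subset_univ _) fun i _ _ => hφ0 _
    have h3 : B.card * β ≤ k / 2 * β := by
      have : (k : ℝ) / 2 * β = M := by rw [hβ]; field_simp
      rw [this]; exact (h1.trans h2).trans hx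
    exact le_of_mul_le_mul_right h3 hβ0
  have hgood : ∀ i ∉ B, |x i| ≤ β + 1 := by
    intro i hi
    have : φ (x i) ≤ β := by simpa [hB] using hi
    linarith [hφu (x i)]
  set E : Finset (Fin n) → ℝ := fun G => Real.exp (∑ i ∈ G, x i) with hE
  have hE0 : ∀ G, 0 ≤ E G := fun G => (Real.exp_pos _).le
  set C := (Finset.univ : Finset (Fin n)).powersetCard m with hC
  have step : ∀ G ∈ C.filter (fun G => S ⊆ G),
      (k : ℝ) / 2 * (m / 2) * (Real.exp (-(2 * (β + 1))) * E G)
        ≤ ∑ a ∈ S, ∑ b ∈ Gᶜ, E (insert b (G.erase a)) := by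
    intro G hG
    obtain ⟨hGC, hSG⟩ := Finset.mem_filter.1 hG
    have hGm : G.card = m := (Finset.mem_powersetCard.1 hGC).2
    have hterm : ∀ a ∈ S \ B, ∀ b ∈ Gᶜ \ B,
        Real.exp (-(2 * (β + 1))) * E G ≤ E (insert b (G.erase a)) := by
      intro a ha b hb
      obtain ⟨haS, haB⟩ := Finset.mem_sdiff.1 ha
      obtain ⟨hbG, hbB⟩ := Finset.mem_sdiff.1 hb
      have hbG' : b ∉ G.erase a := fun h =>
        Finset.mem_compl.1 hbG (Finset.mem_of_mem_erase h)
      simp only [hE]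
      rw [← Real.exp_add, Real.exp_le_exp, Finset.sum_insert hbG',
        ← Finset.add_sum_erase G x (hSG haS)]
      have h1 := abs_le.1 (hgood a haB)
      have h2 := abs_le.1 (hgood b hbB)
      linarith [h1.1, h1.2, h2.1, h2.2]
    have hcS : (k : ℝ) / 2 ≤ (S \ B).card := by
      have : S.card ≤ (S \ B).card + B.card := by
        have := Finset.le_card_sdiff B S
        omega
      have : (k : ℝ) ≤ (S \ B).card + B.card := by rw [← hS]; exact_mod_cast this
      linarith
    have hcG : (m : ℝ) / 2 ≤ (Gᶜ \ B).card := by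
      have h1 : n ≤ (Gᶜ \ B).card + B.card + m := by
        have := Finset.le_card_sdiff B Gᶜ
        rw [Finset.card_compl, Fintype.card_fin, hGm] at this
        omega
      have h2 : (n : ℝ) ≤ (Gᶜ \ B).card + B.card + m := by exact_mod_cast h1
      have h3 : (2 : ℝ) * m ≤ n := by exact_mod_cast hmn
      have h4 : (k : ℝ) ≤ m := by exact_mod_cast hkm
      linarith
    have hw : 0 ≤ Real.exp (-(2 * (β + 1))) * E G := mul_nonneg (Real.exp_pos _).le (hE0 G)
    calc (k : ℝ) / 2 * (m / 2) * (Real.exp (-(2 * (β + 1))) * E G)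
        ≤ (S \ B).card * (Gᶜ \ B).card * (Real.exp (-(2 * (β + 1))) * E G) := by gcongr
      _ = ∑ a ∈ S \ B, ∑ b ∈ Gᶜ \ B, Real.exp (-(2 * (β + 1))) * E G := by
          simp only [Finset.sum_const, nsmul_eq_mul]; ring
      _ ≤ ∑ a ∈ S \ B, ∑ b ∈ Gᶜ \ B, E (insert b (G.erase a)) :=
          Finset.sum_le_sum fun a ha => Finset.sum_le_sum fun b hb => hterm a ha b hb
      _ ≤ ∑ a ∈ S \ B, ∑ b ∈ Gᶜ, E (insert b (G.erase a)) :=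
          Finset.sum_le_sum fun a _ => Finset.sum_le_sum_of_subset_of_nonneg
            Finset.sdiff_subset fun _ _ _ => hE0 _
      _ ≤ ∑ a ∈ S, ∑ b ∈ Gᶜ, E (insert b (G.erase a)) :=
          Finset.sum_le_sum_of_subset_of_nonneg Finset.sdiff_subset
            fun _ _ _ => Finset.sum_nonneg fun _ _ => hE0 _
  have h1 := (Finset.sum_le_sum step).trans (sum_sum_sum_swap_le S m E hE0)
  rw [← Finset.mul_sum, ← Finset.mul_sum] at h1
  refine le_of_mul_le_mul_left ?_ hm0
  refine le_trans (le_of_eq ?_) h1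
  ring

namespace DecisionTree

variable {n : ℕ}

/-- The indicator of the event that an answer is given and is wrong: it does not consist of `k` arms
of `G`. -/
def wrong (k : ℕ) (G : Finset (Fin n)) (o : Option (Finset (Fin n))) : ℝ :=
  match o with
  | none => 0
  | some S => if S.card = k ∧ S ⊆ G then 0 else 1

/-- The indicator of the event that an answer is given and consists of `k` arms of `G`. -/
def right (k : ℕ) (G : Finset (Fin n)) (o : Option (Finset (Fin n))) : ℝ :=
  match o with
  | none => 0
  | some S => if S.card = k ∧ S ⊆ G then 1 else 0

/-- The indicator of the event that the procedure is cut off before it answers. -/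
def cut (o : Option (Finset (Fin n))) : ℝ :=
  match o with
  | none => 1
  | some _ => 0

theorem wrong_nonneg (k : ℕ) (G : Finset (Fin n)) (o : Option (Finset (Fin n))) :
    0 ≤ wrong k G o := by
  rcases o with _ | S
  · exact le_rfl
  · simp only [wrong]; split_ifs <;> norm_num

theorem cut_nonneg (o : Option (Finset (Fin n))) : 0 ≤ cut o := by
  rcases o with _ | S <;> simp [cut]

theorem right_eq (k : ℕ) (G : Finset (Fin n)) (o : Option (Finset (Fin n))) :
    right k G o = 1 + (-1) * (wrong k G o + cut o) := by
  rcases o with _ | S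
  · simp [right, wrong, cut]
  · simp only [right, wrong, cut]; split_ifs <;> ring

variable {ε : ℝ}

theorem expect_right (k : ℕ) (G : Finset (Fin n)) (T : DecisionTree n) :
    T.expect ε G (fun o _ => right k G o) 0
      = 1 - (T.expect ε G (fun o _ => wrong k G o) 0 + T.expect ε G (fun o _ => cut o) 0) := by
  simp only [right_eq, expect_add, expect_const_mul, expect_const]
  ring

/-- The confidence lower bound for a decision tree, averaged over the sets `G` of good arms: if
wrong answers are rare, then `ε² / M` times the number of samples must be large. -/
theorem confidence_bound (h0 : 0 < ε) (h1 : ε < 1 / 4) {m k : ℕ} (hk : 1 ≤ k) (hkm : k ≤ m)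
    (hmn : 2 * m ≤ n) {M : ℝ} (hM : 0 < M) (T : DecisionTree n) :
    (k : ℝ) / 4 * Real.exp (-(2 * (2 * M / k + 1)))
        * ∑ G ∈ (Finset.univ : Finset (Fin n)).powersetCard m,
          (T.expect ε G (fun o _ => right k G o) 0 - 30 * ε ^ 2 / M * T.draws ε G)
      ≤ ∑ G ∈ (Finset.univ : Finset (Fin n)).powersetCard m,
          T.expect ε G (fun o _ => wrong k G o) 0 := by
  set θ := (k : ℝ) / 4 * Real.exp (-(2 * (2 * M / k + 1))) with hθ
  have hθ0 : 0 ≤ θ := by positivity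
  set Φ : (Fin n → ℝ) → ℝ := fun x => ∑ i, (√(1 + x i ^ 2) - 1) with hΦ
  have hΦ0 : ∀ x, 0 ≤ Φ x := fun x => Finset.sum_nonneg fun i _ =>
    sub_nonneg.2 (Real.one_le_sqrt.2 (by nlinarith [sq_nonneg (x i)]))
  set C := (Finset.univ : Finset (Fin n)).powersetCard m with hC
  have hpot : ∀ G, T.expect ε G (fun _ x => Φ x) 0 ≤ 30 * ε ^ 2 * T.draws ε G := by
    intro G
    have := expect_le_add_draws (G := G) (Φ := Φ) (κ := 30 * ε ^ 2) h0 h1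
      (fun a x => drift_sum (G := G) Finset.univ (fun u => √(1 + u ^ 2) - 1) (by positivity)
        (fun a _ u => sqrt_drift h0 h1 G a u) a x) T 0
    simpa [hΦ] using this
  -- After the change of measure all `G` are compared at the same leaf. The potential does not
  -- depend on `G`; if it exceeds `M`, then the left-hand side is nonpositive.
  have hleaf : ∀ (o : Option (Finset (Fin n))) (x : Fin n → ℝ),
      ∑ G ∈ C, θ * (Real.exp (∑ i ∈ G, x i) * (right k G o + (-(1 / M)) * Φ x))
        ≤ ∑ G ∈ C, Real.exp (∑ i ∈ G, x i) * wrong k G o := by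
    intro o x
    have hr : ∀ G, right k G o ≤ 1 := fun G => by
      rcases o with _ | S
      · simp [right]
      · simp only [right]; split_ifs <;> norm_num
    have htriv : (∀ G, right k G o ≤ 1 / M * Φ x) →
        ∑ G ∈ C, θ * (Real.exp (∑ i ∈ G, x i) * (right k G o + (-(1 / M)) * Φ x))
          ≤ ∑ G ∈ C, Real.exp (∑ i ∈ G, x i) * wrong k G o := fun h =>
      Finset.sum_le_sum fun G _ => le_trans
        (mul_nonpos_of_nonneg_of_nonpos hθ0 (mul_nonpos_of_nonneg_of_nonpos (Real.exp_pos _).le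
          (by linarith [h G]))) (mul_nonneg (Real.exp_pos _).le (wrong_nonneg k G o))
    have hMΦ : 0 ≤ 1 / M * Φ x := mul_nonneg (by positivity) (hΦ0 x)
    rcases le_or_gt (Φ x) M with hxM | hxM
    · rcases o with _ | S
      · exact htriv fun G => hMΦ
      · by_cases hS : S.card = k
        · have := sum_exp_subset_le hk hkm hmn hS x hM hxM
          rw [← hθ, Finset.sum_filter, Finset.sum_filter, Finset.mul_sum] at this
          refine le_trans (Finset.sum_le_sum fun G _ => ?_) (this.trans (le_of_eq ?_))
          · refine mul_le_mul_of_nonneg_left ?_ hθ0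
            have h2 : right k G (some S) + -(1 / M) * Φ x ≤ right k G (some S) := by linarith
            refine (mul_le_mul_of_nonneg_left h2 (Real.exp_pos _).le).trans (le_of_eq ?_)
            simp [right, hS]
          · refine Finset.sum_congr rfl fun G _ => ?_
            simp only [wrong, hS, true_and]
            split_ifs <;> simp
        · exact htriv fun G => by simpa [right, hS] using hMΦ
    · refine htriv fun G => (hr G).trans ?_
      rw [one_div, inv_mul_eq_div, le_div_iff₀ hM]
      linarith
  have key := expect_mono (G := ∅) h0 h1 hleaf T 0
  simp only [expect_sum, expect_const_mul] at key
  simp only [← expect_eq_expect_empty h0 h1] at key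
  refine le_trans ?_ key
  rw [Finset.mul_sum]
  refine Finset.sum_le_sum fun G _ => mul_le_mul_of_nonneg_left ?_ hθ0
  rw [expect_add, expect_const_mul]
  have := mul_le_mul_of_nonneg_left (hpot G) (show 0 ≤ 1 / M by positivity)
  have e : 1 / M * (30 * ε ^ 2 * T.draws ε G) = 30 * ε ^ 2 / M * T.draws ε G := by ring
  linarith

theorem exp_mul_indicator_le (u : ℝ) {f : ℝ} (hf : f = 0 ∨ f = 1) :
    Real.exp u * f ≤ Real.exp 1 * f + 4 * (Real.exp u - 1 - u) := by
  have h1 : 0 ≤ Real.exp u - 1 - u := by linarith [Real.add_one_le_exp u]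
  rcases hf with rfl | rfl
  · simpa using h1
  · rcases le_or_gt u 1 with hu | hu
    · have := Real.exp_le_exp.2 hu
      linarith
    · have h2 : Real.exp u = Real.exp 1 * Real.exp (u - 1) := by rw [← Real.exp_add]; ring_nf
      have h3 := Real.add_one_le_exp (u - 1)
      have h4 := Real.exp_one_gt_d9
      nlinarith [mul_le_mul_of_nonneg_left h3 (Real.exp_pos 1).le]

/-- The search lower bound for a decision tree: on average over `G`, correct answers are rare unless
`ε² * N` is large. A good arm `b` of `G` is compared with the situation in which only `H = G \ {b}`
is good. There the answer contains at most `k` of the arms outside `H`, and the potential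
`exp u - 1 - u`, summed over these arms, bounds by how much their likelihood ratios can raise the
probability of being returned. -/
theorem search_bound (h0 : 0 < ε) (h1 : ε < 1 / 4) {m k N : ℕ} (T : DecisionTree n)
    (hT : T.depth ≤ N) :
    k * ∑ G ∈ (Finset.univ : Finset (Fin n)).powersetCard (m + 1),
          T.expect ε G (fun o _ => right k G o) 0
      ≤ (n.choose m : ℝ) * (Real.exp 1 * k + 48 * ε ^ 2 * N) := by
  -- the indicator that `b` belongs to an answer of the right size
  set F : Fin n → Option (Finset (Fin n)) → ℝ := fun b o =>
    match o with
    | none => 0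
    | some S => if S.card = k ∧ b ∈ S then 1 else 0 with hF
  have hF01 : ∀ b o, F b o = 0 ∨ F b o = 1 := by
    intro b o
    rcases o with _ | S
    · exact Or.inl rfl
    · simp only [hF]; split_ifs <;> simp
  have hFs : ∀ (s : Finset (Fin n)) o, ∑ b ∈ s, F b o ≤ k := by
    intro s o
    rcases o with _ | S
    · simp [hF]
    · by_cases hS : S.card = k
      · simp only [hF, hS, true_and, Finset.sum_ite_mem, Finset.sum_const, nsmul_eq_mul, mul_one]
        exact_mod_cast hS ▸ Finset.card_le_card Finset.inter_subset_right
      · simp [hF, hS]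
  have hright : ∀ G o, k * right k G o ≤ ∑ b ∈ G, F b o := by
    intro G o
    rcases o with _ | S
    · simp [hF, right]
    · by_cases hS : S.card = k
      · by_cases hSG : S ⊆ G
        · simp only [hF, right, hS, hSG, true_and, and_self, if_true, Finset.sum_ite_mem,
            Finset.inter_eq_right.2 hSG, Finset.sum_const, nsmul_eq_mul, le_refl]
        · simp only [right, hS, hSG, and_false, if_false, mul_zero]
          exact Finset.sum_nonneg fun b _ => by rcases hF01 b (some S) with h | h <;> simp [h]
      · simp [hF, right, hS]
  have hH : ∀ H : Finset (Fin n), ∑ b ∈ Hᶜ, T.expect ε (insert b H) (fun o _ => F b o) 0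
      ≤ Real.exp 1 * k + 48 * ε ^ 2 * N := by
    intro H
    set Ψ : (Fin n → ℝ) → ℝ := fun x => ∑ i ∈ Hᶜ, (Real.exp (x i) - 1 - x i) with hΨ
    have hpot : T.expect ε H (fun _ x => Ψ x) 0 ≤ 12 * ε ^ 2 * N := by
      have := expect_le_add_draws (G := H) (Φ := Ψ) (κ := 12 * ε ^ 2) h0 h1
        (fun a x => drift_sum (G := H) Hᶜ (fun u => Real.exp u - 1 - u) (by positivity)
          (fun a ha u => exp_drift h0 h1 (Finset.mem_compl.1 ha) u) a x) T 0
      refine this.trans ?_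
      have h2 : T.draws ε H ≤ N := (draws_le_depth h0 h1 T).trans (by exact_mod_cast hT)
      have h3 := mul_le_mul_of_nonneg_left h2 (show 0 ≤ 12 * ε ^ 2 by positivity)
      simpa [hΨ] using h3
    have h2 : ∑ b ∈ Hᶜ, T.expect ε (insert b H) (fun o _ => F b o) 0
        = T.expect ε H (fun o x => ∑ b ∈ Hᶜ, Real.exp (x b) * F b o) 0 := by
      rw [expect_sum]
      exact Finset.sum_congr rfl fun b hb => expect_insert h0 h1 (Finset.mem_compl.1 hb) T
    rw [h2]
    have h3 : ∀ (o : Option (Finset (Fin n))) (x : Fin n → ℝ),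
        ∑ b ∈ Hᶜ, Real.exp (x b) * F b o ≤ Real.exp 1 * k + 4 * Ψ x := by
      intro o x
      calc ∑ b ∈ Hᶜ, Real.exp (x b) * F b o
          ≤ ∑ b ∈ Hᶜ, (Real.exp 1 * F b o + 4 * (Real.exp (x b) - 1 - x b)) :=
            Finset.sum_le_sum fun b _ => exp_mul_indicator_le _ (hF01 b o)
        _ = Real.exp 1 * ∑ b ∈ Hᶜ, F b o + 4 * Ψ x := by
            rw [Finset.sum_add_distrib, Finset.mul_sum, Finset.mul_sum]
        _ ≤ _ := by
            have := mul_le_mul_of_nonneg_left (hFs Hᶜ o) (Real.exp_pos 1).le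
            linarith
    have h4 := expect_mono (G := H) h0 h1 h3 T 0
    rw [expect_add, expect_const, expect_const_mul] at h4
    linarith
  calc k * ∑ G ∈ (Finset.univ : Finset (Fin n)).powersetCard (m + 1),
          T.expect ε G (fun o _ => right k G o) 0
      = ∑ G ∈ (Finset.univ : Finset (Fin n)).powersetCard (m + 1),
          T.expect ε G (fun o _ => k * right k G o) 0 := by
        simp only [Finset.mul_sum, expect_const_mul]
    _ ≤ ∑ G ∈ (Finset.univ : Finset (Fin n)).powersetCard (m + 1),
          ∑ b ∈ G, T.expect ε G (fun o _ => F b o) 0 := by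
        refine Finset.sum_le_sum fun G _ => ?_
        rw [← expect_sum]
        exact expect_mono h0 h1 (fun o _ => hright G o) T 0
    _ = ∑ H ∈ (Finset.univ : Finset (Fin n)).powersetCard m,
          ∑ b ∈ Hᶜ, T.expect ε (insert b H) (fun o _ => F b o) 0 :=
        sum_erase_eq_sum_insert m fun G b => T.expect ε G (fun o _ => F b o) 0
    _ ≤ ∑ H ∈ (Finset.univ : Finset (Fin n)).powersetCard m,
          (Real.exp 1 * k + 48 * ε ^ 2 * N) := Finset.sum_le_sum fun H _ => hH H
    _ = _ := by
        rw [Finset.sum_const, Finset.card_powersetCard, Finset.card_univ, Fintype.card_fin,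
          nsmul_eq_mul]

end DecisionTree

/-! ### The hard instance -/

theorem rewardProb_false {n : ℕ} (ε : ℝ) (G : Finset (Fin n)) (a : Fin n) :
    rewardProb ε G a false = 1 - rewardProb ε G a true := by
  have := sum_rewardProb ε G a
  rw [Fintype.sum_bool] at this
  linarith

/-- The law on `[0,1]` of a reward that is `1` with probability `p` and `0` otherwise. -/
def bernoulliLaw (p : ℝ) (h0 : 0 ≤ p) (h1 : p ≤ 1) : ProbabilityMeasure unitInterval :=
  ⟨ENNReal.ofReal p • Measure.dirac 1 + ENNReal.ofReal (1 - p) • Measure.dirac 0, ⟨by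
    simp [← ENNReal.ofReal_add h0 (sub_nonneg.2 h1)]⟩⟩

/-- The hard instance: Bernoulli rewards with mean `1 / 2 + ε` for the arms in `G` and `1 / 2 - ε`
for the others. The gap `2 * ε` exceeds `ε`, so only the arms in `G` are optimal. -/
def twoLevelArms {n : ℕ} {ε : ℝ} (h0 : 0 < ε) (h1 : ε < 1 / 4) (G : Finset (Fin n)) :
    ArmSet n :=
  fun a => bernoulliLaw (rewardProb ε G a true) (rewardProb_nonneg h0 h1 G a true)
    (by linarith [rewardProb_false ε G a, rewardProb_nonneg h0 h1 G a false])

/-- A reward bit as an element of `[0,1]`. -/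
def bitReward (b : Bool) : unitInterval := if b then 1 else 0

theorem twoLevelArms_singleton {n : ℕ} {ε : ℝ} (h0 : 0 < ε) (h1 : ε < 1 / 4)
    (G : Finset (Fin n)) (a : Fin n) (b : Bool) :
    (twoLevelArms h0 h1 G a : Measure unitInterval) {bitReward b}
      = ENNReal.ofReal (rewardProb ε G a b) := by
  have e : (twoLevelArms h0 h1 G a : Measure unitInterval)
      = ENNReal.ofReal (rewardProb ε G a true) • Measure.dirac 1
        + ENNReal.ofReal (1 - rewardProb ε G a true) • Measure.dirac 0 := rfl
  rw [e]
  cases b <;> simp [bitReward, rewardProb_false]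

theorem twoLevelArms_relabel {n : ℕ} {ε : ℝ} (h0 : 0 < ε) (h1 : ε < 1 / 4)
    (G : Finset (Fin n)) (σ : Equiv.Perm (Fin n)) :
    (twoLevelArms h0 h1 G).relabel σ = twoLevelArms h0 h1 (G.map σ.symm.toEmbedding) := by
  funext i
  have h : i ∈ G.map σ.symm.toEmbedding ↔ σ i ∈ G := by
    simp [Finset.mem_map_equiv]
  simp only [ArmSet.relabel, twoLevelArms, rewardProb, h]

theorem mean_twoLevelArms {n : ℕ} {ε : ℝ} (h0 : 0 < ε) (h1 : ε < 1 / 4)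
    (G : Finset (Fin n)) (a : Fin n) :
    (twoLevelArms h0 h1 G).mean a = if a ∈ G then 1 / 2 + ε else 1 / 2 - ε := by
  have e : (twoLevelArms h0 h1 G a : Measure unitInterval)
      = ENNReal.ofReal (rewardProb ε G a true) • Measure.dirac 1
        + ENNReal.ofReal (1 - rewardProb ε G a true) • Measure.dirac 0 := rfl
  have hi : ∀ (c : ℝ≥0∞) (y : unitInterval), c ≠ ∞ →
      Integrable (fun x : unitInterval => (x : ℝ)) (c • Measure.dirac y) := fun c y hc =>
    (integrable_dirac (by simp)).smul_measure hc
  rw [ArmSet.mean, e, integral_add_measure (hi _ _ ENNReal.ofReal_ne_top)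
    (hi _ _ ENNReal.ofReal_ne_top), integral_smul_measure, integral_smul_measure,
    integral_dirac, integral_dirac,
    ENNReal.toReal_ofReal (rewardProb_nonneg h0 h1 G a true)]
  simp [rewardProb]

theorem mem_of_isOptimal {n : ℕ} {ε : ℝ} (h0 : 0 < ε) (h1 : ε < 1 / 4) {G : Finset (Fin n)}
    {m : ℕ} (hm : 1 ≤ m) (hG : G.card = m) {a : Fin n}
    (ha : (twoLevelArms h0 h1 G).IsOptimal ε m a) : a ∈ G := by
  have hl : mthLargest (twoLevelArms h0 h1 G).mean m = 1 / 2 + ε := by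
    refine IsGreatest.csSup_eq ⟨?_, ?_⟩
    · rw [Set.mem_ofPred_eq, ← hG]
      refine Finset.card_le_card fun i hi => ?_
      simp [mean_twoLevelArms, hi]
    · intro x hx
      have hpos : 0 < (Finset.univ.filter fun a => x ≤ (twoLevelArms h0 h1 G).mean a).card :=
        lt_of_lt_of_le hm hx
      obtain ⟨i, hi⟩ := Finset.card_pos.1 hpos
      have h2 := (Finset.mem_filter.1 hi).2
      rw [mean_twoLevelArms] at h2
      split_ifs at h2 <;> linarith
  by_contra hna
  rw [ArmSet.IsOptimal, hl, mean_twoLevelArms, if_neg hna] at ha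
  linarith

/-! ### From algorithms to decision trees -/

namespace Algorithm

variable {n : ℕ}

/-- The decision tree of `A` with its internal randomness fixed to `s`, started at the history `h`
and cut off if `A` does not stop within `r` further samples. Only histories with rewards in
`{0, 1}` are followed. -/
def tree (A : Algorithm n) (s : A.Seed) : (r t : ℕ) → History n t → DecisionTree n
  | 0, t, h =>
    match A.move t (s, h) with
    | Move.halt S => .leaf (some S)
    | Move.sample _ => .leaf none
  | r + 1, t, h =>
    match A.move t (s, h) with
    | Move.halt S => .leaf (some S)
    | Move.sample a => .node a fun b => A.tree s r (t + 1) (Fin.snoc h (a, bitReward b))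

variable (A : Algorithm n)

theorem tree_of_halt {s : A.Seed} {t : ℕ} {h : History n t} {S : Finset (Fin n)}
    (hm : A.move t (s, h) = Move.halt S) (r : ℕ) : A.tree s r t h = .leaf (some S) := by
  cases r <;> simp [tree, hm]

theorem tree_zero_of_sample {s : A.Seed} {t : ℕ} {h : History n t} {a : Fin n}
    (hm : A.move t (s, h) = Move.sample a) : A.tree s 0 t h = .leaf none := by
  simp [tree, hm]

theorem tree_succ_of_sample {s : A.Seed} {t : ℕ} {h : History n t} {a : Fin n}
    (hm : A.move t (s, h) = Move.sample a) (r : ℕ) : A.tree s (r + 1) t h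
      = .node a fun b => A.tree s r (t + 1) (Fin.snoc h (a, bitReward b)) := by
  simp [tree, hm]

theorem depth_tree_le (s : A.Seed) (r t : ℕ) (h : History n t) :
    (A.tree s r t h).depth ≤ r := by
  induction r generalizing t h with
  | zero =>
    cases hm : A.move t (s, h) with
    | halt S => simp [A.tree_of_halt hm, DecisionTree.depth]
    | sample a => simp [A.tree_zero_of_sample hm, DecisionTree.depth]
  | succ r ih =>
    cases hm : A.move t (s, h) with
    | halt S => simp [A.tree_of_halt hm, DecisionTree.depth]
    | sample a =>
      rw [A.tree_succ_of_sample hm, DecisionTree.depth]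
      have h1 := ih (t + 1) (Fin.snoc h (a, bitReward true))
      have h2 := ih (t + 1) (Fin.snoc h (a, bitReward false))
      omega

theorem history_succ {s : A.Seed} {R : Rewards n} {t : ℕ} {h : History n t}
    (hh : A.history s R t = some h) {a : Fin n} (hm : A.move t (s, h) = Move.sample a) :
    A.history s R (t + 1) = some (Fin.snoc h (a, R (a, h.count a))) := by
  simp [history, hh, hm]

theorem history_succ_eq_some_iff {s : A.Seed} {R : Rewards n} {t : ℕ} {h : History n (t + 1)} :
    A.history s R (t + 1) = some h ↔ A.history s R t = some (Fin.init h) ∧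
      A.move t (s, Fin.init h) = Move.sample (h (Fin.last t)).1 ∧
      R ((h (Fin.last t)).1, History.count (Fin.init h : History n t) (h (Fin.last t)).1)
        = (h (Fin.last t)).2 := by
  constructor
  · intro hh
    rcases ht : A.history s R t with _ | h'
    · simp [history, ht] at hh
    · cases hm : A.move t (s, h') with
      | halt S => simp [history, ht, hm] at hh
      | sample a =>
        rw [A.history_succ ht hm, Option.some.injEq] at hh
        subst hh
        simp [hm]
  · rintro ⟨h1, h2, h3⟩
    rw [A.history_succ h1 h2, h3]
    simp

theorem history_eq_none_of_halt {s : A.Seed} {R : Rewards n} {t : ℕ} {h : History n t}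
    {S : Finset (Fin n)} (hh : A.history s R t = some h) (hm : A.move t (s, h) = Move.halt S)
    {u : ℕ} (hu : t < u) : A.history s R u = none := by
  induction u, hu using Nat.le_induction with
  | base => simp [history, hh, hm]
  | succ u _ ih => simp [history, ih]

theorem Returns.unique {s : A.Seed} {R : Rewards n} {S S' : Finset (Fin n)}
    (h : A.Returns s R S) (h' : A.Returns s R S') : S = S' := by
  obtain ⟨t, h, hh, hm⟩ := h
  obtain ⟨t', h', hh', hm'⟩ := h'
  rcases lt_trichotomy t t' with hlt | rfl | hlt
  · simp [A.history_eq_none_of_halt hh hm hlt] at hh'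
  · rw [hh, Option.some.injEq] at hh'
    subst hh'
    simpa [hm] using hm'
  · simp [A.history_eq_none_of_halt hh' hm' hlt] at hh

/-- A history whose rewards are given by bits. -/
def bitHistory {t : ℕ} (h : Fin t → Fin n × Bool) : History n t :=
  fun i => ((h i).1, bitReward (h i).2)

theorem snoc_bitHistory {t : ℕ} (h : Fin t → Fin n × Bool) (a : Fin n) (b : Bool) :
    (Fin.snoc (bitHistory h) (a, bitReward b) : History n (t + 1))
      = bitHistory (Fin.snoc h (a, b) : Fin (t + 1) → Fin n × Bool) := by
  funext i
  refine Fin.lastCases ?_ (fun j => ?_) i <;> simp [bitHistory]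

/-- The event that sample number `u + 1` is taken and the rewards before it are all `0` or `1`. The
restriction makes it a finite union over bit histories, hence measurable. -/
def sampling (u : ℕ) : Set (A.Seed × Rewards n) :=
  {p | ∃ h : Fin u → Fin n × Bool, A.history p.1 p.2 u = some (bitHistory h) ∧
    ∃ a, A.move u (p.1, bitHistory h) = Move.sample a}

theorem measurableSet_move_section (t : ℕ) (h : History n t) (y : Move n) :
    MeasurableSet {p : A.Seed × Rewards n | A.move t (p.1, h) = y} :=
  (measurable_fst.prodMk measurable_const) (A.measurableSet_move t y)

theorem measurableSet_history (t : ℕ) (h : History n t) :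
    MeasurableSet {p : A.Seed × Rewards n | A.history p.1 p.2 t = some h} := by
  induction t with
  | zero =>
    have : {p : A.Seed × Rewards n | A.history p.1 p.2 0 = some h} = Set.univ := by
      ext p
      simp only [history, Set.mem_ofPred_eq, Set.mem_univ, iff_true, Option.some.injEq]
      exact Subsingleton.elim _ _
    rw [this]
    exact MeasurableSet.univ
  | succ t ih =>
    simp only [history_succ_eq_some_iff]
    exact (ih _).inter ((A.measurableSet_move_section t _ _).inter
      (((measurable_pi_apply _).comp measurable_snd) (measurableSet_singleton _)))

theorem measurableSet_sampling (u : ℕ) : MeasurableSet (A.sampling u) := by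
  have : A.sampling u = ⋃ h : Fin u → Fin n × Bool,
      {p | A.history p.1 p.2 u = some (bitHistory h)} ∩
        ⋃ a, {p | A.move u (p.1, bitHistory h) = Move.sample a} := by
    ext p; simp [sampling]
  rw [this]
  exact MeasurableSet.iUnion fun h => (A.measurableSet_history u _).inter
    (MeasurableSet.iUnion fun a => A.measurableSet_move_section u _ _)

theorem mem_sampling_of_history {s : A.Seed} {R : Rewards n} {t : ℕ}
    {h : Fin t → Fin n × Bool} (hh : A.history s R t = some (bitHistory h)) {u : ℕ}
    (hu : u < t) : (s, R) ∈ A.sampling u := by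
  induction t with
  | zero => omega
  | succ t ih =>
    obtain ⟨h1, h2, -⟩ := A.history_succ_eq_some_iff.1 hh
    rcases Nat.lt_succ_iff_lt_or_eq.1 hu with hlt | rfl
    · exact ih (h := Fin.init h) h1 hlt
    · exact ⟨Fin.init h, h1, _, h2⟩

/-- The number of the first `N + 1` samples that are taken after rewards in `{0, 1}` only: a
measurable lower bound for `numSamples`. -/
def sampleCount (N : ℕ) (p : A.Seed × Rewards n) : ℝ≥0∞ :=
  ∑ u ∈ Finset.range (N + 1), (A.sampling u).indicator 1 p

theorem measurable_sampleCount (N : ℕ) : Measurable (A.sampleCount N) :=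
  Finset.measurable_sum _ fun u _ => measurable_one.indicator (A.measurableSet_sampling u)

theorem sampleCount_le_numSamples (N : ℕ) (p : A.Seed × Rewards n) :
    A.sampleCount N p ≤ A.numSamples p.1 p.2 := by
  refine le_trans (Finset.sum_le_sum fun u _ => ?_) (ENNReal.sum_le_tsum _)
  by_cases hp : p ∈ A.sampling u
  · obtain ⟨h, hh, a, ha⟩ := hp
    rw [A.history_succ hh ha]
    exact Set.indicator_le_self' (by simp) p |>.trans (by simp)
  · simp [hp]

variable {ε : ℝ} (h0 : 0 < ε) (h1 : ε < 1 / 4) (G : Finset (Fin n))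

/-- The joint law of all rewards of the hard instance. -/
abbrev rewardLaw : Measure (Rewards n) :=
  Measure.infinitePi fun p : Fin n × ℕ => (twoLevelArms h0 h1 G p.1 : Measure unitInterval)

/-- The event that the rewards with index in `I` have the values prescribed by `v`. -/
abbrev cylinder (I : Finset (Fin n × ℕ)) (v : Fin n × ℕ → unitInterval) : Set (Rewards n) :=
  Set.pi ↑I fun i => {v i}

theorem measurableSet_cylinder (I : Finset (Fin n × ℕ)) (v : Fin n × ℕ → unitInterval) :
    MeasurableSet (cylinder I v) :=
  MeasurableSet.pi (Finset.countable_toSet I) fun i _ => measurableSet_singleton (v i)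

theorem cylinder_insert {I : Finset (Fin n × ℕ)} {i : Fin n × ℕ} (hi : i ∉ I)
    (v : Fin n × ℕ → unitInterval) (y : unitInterval) :
    cylinder (insert i I) (Function.update v i y) = cylinder I v ∩ {R | R i = y} := by
  ext R
  simp only [cylinder, Set.mem_pi, Finset.mem_coe, Finset.mem_insert, forall_eq_or_imp,
    Function.update_self, Set.mem_singleton_iff, Set.mem_inter_iff, Set.mem_ofPred_eq]
  rw [and_comm]
  refine and_congr (forall₂_congr fun j hj => ?_) Iff.rfl
  rw [Function.update_of_ne (ne_of_mem_of_not_mem hj hi)]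

theorem rewardLaw_cylinder_insert {I : Finset (Fin n × ℕ)} {i : Fin n × ℕ} (hi : i ∉ I)
    (v : Fin n × ℕ → unitInterval) (b : Bool) :
    rewardLaw h0 h1 G (cylinder (insert i I) (Function.update v i (bitReward b)))
      = rewardLaw h0 h1 G (cylinder I v) * ENNReal.ofReal (rewardProb ε G i.1 b) := by
  rw [cylinder, cylinder, Measure.infinitePi_pi _ (fun _ _ => measurableSet_singleton _),
    Measure.infinitePi_pi _ (fun _ _ => measurableSet_singleton _), Finset.prod_insert hi,
    Function.update_self, twoLevelArms_singleton, mul_comm]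
  congr 1
  refine Finset.prod_congr rfl fun j hj => ?_
  rw [Function.update_of_ne (ne_of_mem_of_not_mem hj hi)]

theorem sum_cylinder_insert_le {I : Finset (Fin n × ℕ)} {i : Fin n × ℕ} (hi : i ∉ I)
    (v : Fin n × ℕ → unitInterval) (Λ : Measure (Rewards n)) :
    ∑ b, Λ (cylinder (insert i I) (Function.update v i (bitReward b))) ≤ Λ (cylinder I v) := by
  rw [Fintype.sum_bool, ← measure_union _ (measurableSet_cylinder _ _)]
  · refine measure_mono (Set.union_subset ?_ ?_) <;> rw [cylinder_insert hi] <;>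
      exact Set.inter_subset_left
  · rw [cylinder_insert hi, cylinder_insert hi, Set.disjoint_left]
    rintro R ⟨-, hR⟩ ⟨-, hR'⟩
    rw [Set.mem_ofPred_eq] at hR hR'
    rw [hR] at hR'
    simp [bitReward] at hR'

theorem count_snoc {t : ℕ} (h : History n t) (a a' : Fin n) (y : unitInterval) :
    History.count (Fin.snoc h (a, y) : History n (t + 1)) a'
      = h.count a' + if a = a' then 1 else 0 := by
  simp only [History.count, Finset.card_filter, Fin.sum_univ_castSucc, Fin.snoc_castSucc,
    Fin.snoc_last]

/-- Transfer from decision trees to the random rewards. Let `U` be a functional of trees (and of the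
number of samples taken before) that at a node is at most the mean of its values on the subtrees. If
a measure `Λ` of the reward space is at least `U` times the reward law on the events that
correspond to leaves, then its total mass is at least the value of `U` on the whole tree. -/
theorem rewardLaw_mul_tree_le (s : A.Seed) (N : ℕ) (Λ : Measure (Rewards n))
    (U : ℕ → DecisionTree n → ℝ)
    (hU : ∀ t T, 0 ≤ U t T)
    (hnode : ∀ t a next, U t (.node a next) ≤ ∑ b, rewardProb ε G a b * U (t + 1) (next b))
    (hleaf : ∀ t ≤ N, ∀ (h : Fin t → Fin n × Bool) (C : Set (Rewards n)), MeasurableSet C →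
      (∀ R ∈ C, A.history s R t = some (bitHistory h)) → ∀ S,
      A.move t (s, bitHistory h) = Move.halt S →
      rewardLaw h0 h1 G C * ENNReal.ofReal (U t (.leaf (some S))) ≤ Λ C)
    (hcut : ∀ (h : Fin N → Fin n × Bool) (C : Set (Rewards n)), MeasurableSet C →
      (∀ R ∈ C, A.history s R N = some (bitHistory h)) → ∀ a,
      A.move N (s, bitHistory h) = Move.sample a →
      rewardLaw h0 h1 G C * ENNReal.ofReal (U N (.leaf none)) ≤ Λ C) :
    ENNReal.ofReal (U 0 (A.tree s N 0 Fin.elim0)) ≤ Λ Set.univ := by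
  -- The rewards already seen are recorded in a cylinder over indices `(a, j)` with `j` below the
  -- number of samples of arm `a`, so that the next reward is independent of it.
  have key : ∀ (r t : ℕ) (h : Fin t → Fin n × Bool) (I : Finset (Fin n × ℕ))
      (v : Fin n × ℕ → unitInterval), t + r = N →
      (∀ R ∈ cylinder I v, A.history s R t = some (bitHistory h)) →
      (∀ i ∈ I, i.2 < (bitHistory h).count i.1) →
      rewardLaw h0 h1 G (cylinder I v) * ENNReal.ofReal (U t (A.tree s r t (bitHistory h)))
        ≤ Λ (cylinder I v) := by
    intro r
    induction r with
    | zero =>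
      intro t h I v ht hR _
      obtain rfl : t = N := by omega
      cases hm : A.move t (s, bitHistory h) with
      | halt S =>
        rw [A.tree_of_halt hm]
        exact hleaf t (by omega) h _ (measurableSet_cylinder I v) hR S hm
      | sample a =>
        rw [A.tree_zero_of_sample hm]
        exact hcut h _ (measurableSet_cylinder I v) hR a hm
    | succ r ih =>
      intro t h I v ht hR hI
      cases hm : A.move t (s, bitHistory h) with
      | halt S =>
        rw [A.tree_of_halt hm]
        exact hleaf t (by omega) h _ (measurableSet_cylinder I v) hR S hm
      | sample a =>
        rw [A.tree_succ_of_sample hm]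
        set i : Fin n × ℕ := (a, (bitHistory h).count a) with hi
        have hiI : i ∉ I := fun hmem => lt_irrefl _ (hI i hmem)
        refine le_trans ?_ (sum_cylinder_insert_le hiI v Λ)
        have step : ∀ b, rewardLaw h0 h1 G (cylinder I v) * ENNReal.ofReal
            (rewardProb ε G a b * U (t + 1)
              (A.tree s r (t + 1) (Fin.snoc (bitHistory h) (a, bitReward b))))
            ≤ Λ (cylinder (insert i I) (Function.update v i (bitReward b))) := by
          intro b
          rw [ENNReal.ofReal_mul (rewardProb_nonneg h0 h1 G a b), ← mul_assoc,
            ← rewardLaw_cylinder_insert h0 h1 G hiI v b, snoc_bitHistory]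
          refine ih (t + 1) _ _ _ (by omega) ?_ ?_
          · intro R hRm
            rw [cylinder_insert hiI] at hRm
            rw [A.history_succ (hR R hRm.1) hm, ← snoc_bitHistory]
            have h2 : R (a, (bitHistory h).count a) = bitReward b := hRm.2
            rw [h2]
          · intro j hj
            rw [← snoc_bitHistory, count_snoc]
            rcases Finset.mem_insert.1 hj with rfl | hj
            · simp [hi]
            · exact Nat.lt_add_right _ (hI j hj)
        refine le_trans ?_ (Finset.sum_le_sum fun b _ => step b)
        rw [← Finset.mul_sum, ← ENNReal.ofReal_sum_of_nonneg
          (fun b _ => mul_nonneg (rewardProb_nonneg h0 h1 G a b) (hU _ _))]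
        exact mul_le_mul_right (ENNReal.ofReal_le_ofReal (hnode _ _ _)) _
  have h := key N 0 Fin.elim0 ∅ (fun _ => 0) (by omega)
    (fun R _ => by simp only [history, Option.some.injEq]; exact Subsingleton.elim _ _) (by simp)
  have e : bitHistory (Fin.elim0 : Fin 0 → Fin n × Bool) = Fin.elim0 := Subsingleton.elim _ _
  rw [e] at h
  simpa [cylinder] using h

end Algorithm

namespace DecisionTree

variable {n : ℕ} {ε : ℝ} {G : Finset (Fin n)}

theorem expect_answer_eq (f : Option (Finset (Fin n)) → ℝ) (T : DecisionTree n)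
    (x y : Fin n → ℝ) : T.expect ε G (fun o _ => f o) x = T.expect ε G (fun o _ => f o) y := by
  induction T generalizing x y with
  | leaf o => rfl
  | node a next ih => exact Finset.sum_congr rfl fun b _ => by rw [ih b _ _]

end DecisionTree

namespace Algorithm

open DecisionTree

variable {n : ℕ} (A : Algorithm n) {ε : ℝ} (h0 : 0 < ε) (h1 : ε < 1 / 4) (G : Finset (Fin n))

theorem expect_wrong_le (s : A.Seed) (N k : ℕ) {E : Set (Rewards n)}
    (hE : ∀ R S, A.Returns s R S → ¬ (S.card = k ∧ S ⊆ G) → R ∈ E) :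
    ENNReal.ofReal ((A.tree s N 0 Fin.elim0).expect ε G (fun o _ => wrong k G o) 0)
      ≤ rewardLaw h0 h1 G E := by
  have := A.rewardLaw_mul_tree_le h0 h1 G s N ((rewardLaw h0 h1 G).restrict E)
    (fun _ T => T.expect ε G (fun o _ => wrong k G o) 0)
    (fun _ T => expect_nonneg h0 h1 (fun o _ => wrong_nonneg k G o) T 0)
    (fun _ a next => Finset.sum_le_sum fun b _ => le_of_eq (by
      rw [expect_answer_eq (wrong k G)])) ?_ ?_
  · rwa [Measure.restrict_apply_univ] at this
  · intro t _ h C hC hR S hm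
    by_cases hS : S.card = k ∧ S ⊆ G
    · simp [expect, wrong, hS]
    · rw [Measure.restrict_apply hC, Set.inter_eq_left.2 fun R hRC =>
        hE R S ⟨t, _, hR R hRC, hm⟩ hS]
      simp [expect, wrong, hS]
  · intro h C _ _ a _
    simp [expect, wrong]

theorem draws_add_cut_le (s : A.Seed) (N : ℕ) :
    ENNReal.ofReal ((A.tree s N 0 Fin.elim0).draws ε G
        + (A.tree s N 0 Fin.elim0).expect ε G (fun o _ => cut o) 0)
      ≤ ∫⁻ R, A.sampleCount N (s, R) ∂(rewardLaw h0 h1 G) := by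
  have hcount : ∀ (t : ℕ) (h : Fin t → Fin n × Bool) R, t ≤ N + 1 →
      A.history s R t = some (bitHistory h) → (t : ℝ≥0∞) ≤ A.sampleCount N (s, R) := by
    intro t h R ht hh
    calc (t : ℝ≥0∞) = ∑ u ∈ Finset.range t, (A.sampling u).indicator 1 (s, R) := by
          rw [Finset.sum_congr rfl fun u hu => Set.indicator_of_mem
            (A.mem_sampling_of_history hh (Finset.mem_range.1 hu)) _]
          simp
      _ ≤ _ := Finset.sum_le_sum_of_subset (Finset.range_subset_range.2 ht)
  have := A.rewardLaw_mul_tree_le h0 h1 G s N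
    ((rewardLaw h0 h1 G).withDensity fun R => A.sampleCount N (s, R))
    (fun t T => t + (T.draws ε G + T.expect ε G (fun o _ => cut o) 0))
    (fun t T => add_nonneg (Nat.cast_nonneg t) (add_nonneg (draws_nonneg h0 h1 T)
      (expect_nonneg h0 h1 (fun o _ => cut_nonneg o) T 0))) ?_ ?_ ?_
  · rwa [withDensity_apply _ MeasurableSet.univ, Measure.restrict_univ, Nat.cast_zero,
      zero_add] at this
  · intro t a next
    refine le_of_eq ?_
    have e : ∀ b, (next b).expect ε G (fun o _ => cut o) (0 + Pi.single a (logRatio ε b))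
        = (next b).expect ε G (fun o _ => cut o) 0 := fun b => expect_answer_eq cut _ _ _
    simp only [draws, expect, e, mul_add, Finset.sum_add_distrib]
    rw [← Finset.sum_mul, sum_rewardProb]
    push_cast
    ring
  · intro t ht h C hC hR S hm
    rw [withDensity_apply _ hC, mul_comm, ← setLIntegral_const]
    refine setLIntegral_mono' hC fun R hRC => ?_
    simp only [draws, expect, cut, add_zero, ENNReal.ofReal_natCast]
    exact hcount t h R (by omega) (hR R hRC)
  · intro h C hC hR a hm
    rw [withDensity_apply _ hC, mul_comm, ← setLIntegral_const]
    refine setLIntegral_mono' hC fun R hRC => ?_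
    rw [sampleCount, Finset.sum_range_succ,
      Set.indicator_of_mem (show (s, R) ∈ A.sampling N from ⟨h, hR R hRC, a, hm⟩),
      Finset.sum_congr rfl fun u hu => Set.indicator_of_mem
        (A.mem_sampling_of_history (hR R hRC) (Finset.mem_range.1 hu)) _]
    simp only [draws, expect, cut, zero_add]
    rw [ENNReal.ofReal_add (Nat.cast_nonneg N) zero_le_one]
    simp

/-- Markov's inequality for the event of being cut off, which means that `N` samples were taken and
one more is requested. -/
theorem cut_le_draws_add_cut (h0 : 0 < ε) (h1 : ε < 1 / 4) (G : Finset (Fin n)) (s : A.Seed) (N : ℕ) :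
    (N + 1) * (A.tree s N 0 Fin.elim0).expect ε G (fun o _ => cut o) 0
      ≤ (A.tree s N 0 Fin.elim0).draws ε G
        + (A.tree s N 0 Fin.elim0).expect ε G (fun o _ => cut o) 0 := by
  have hle : ∀ (T : DecisionTree n) x, T.expect ε G (fun o _ => cut o) x ≤ 1 := fun T x => by
    refine (expect_mono (F' := fun _ _ => 1) h0 h1 (fun o _ => ?_) T x).trans_eq
      (expect_const 1 T x)
    rcases o with _ | S <;> simp [cut]
  have key : ∀ (r t : ℕ) (h : History n t),
      r * (A.tree s r t h).expect ε G (fun o _ => cut o) 0 ≤ (A.tree s r t h).draws ε G := by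
    intro r
    induction r with
    | zero =>
      intro t h
      simpa using draws_nonneg h0 h1 _
    | succ r ih =>
      intro t h
      cases hm : A.move t (s, h) with
      | halt S => simp [A.tree_of_halt hm, draws, expect, cut]
      | sample a =>
        have hT := hle (A.tree s (r + 1) t h) 0
        rw [A.tree_succ_of_sample hm] at hT ⊢
        push_cast
        rw [add_mul, one_mul, draws, add_comm]
        refine add_le_add hT ?_
        rw [expect, Finset.mul_sum]
        refine Finset.sum_le_sum fun b _ => ?_
        rw [expect_answer_eq cut _ _ 0, mul_left_comm]
        exact mul_le_mul_of_nonneg_left (ih _ _) (rewardProb_nonneg h0 h1 G a b)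
  linarith [key N 0 Fin.elim0]

/-- Averaged over the seed, the probability of a wrong answer of the tree is at most the error
probability. The error event need not be measurable as it stands, so the section probabilities of
its measurable hull serve as a measurable majorant. -/
theorem exists_measurable_wrong_le {k m : ℕ} (hm : 1 ≤ m) (hG : G.card = m) (N : ℕ) :
    ∃ f : A.Seed → ℝ≥0∞, Measurable f ∧
      (∀ s, ENNReal.ofReal ((A.tree s N 0 Fin.elim0).expect ε G (fun o _ => wrong k G o) 0)
        ≤ f s) ∧
      ∫⁻ s, f s ∂(A.seedLaw : Measure A.Seed) ≤ A.errorProb (twoLevelArms h0 h1 G) k m ε := by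
  set E : Set (A.Seed × Rewards n) := {p | ¬ ∃ S : Finset (Fin n), A.Returns p.1 p.2 S ∧
    S.card = k ∧ ∀ a ∈ S, (twoLevelArms h0 h1 G).IsOptimal ε m a} with hE
  set E' := toMeasurable (A.law (twoLevelArms h0 h1 G)) E with hE'
  have hm' : MeasurableSet E' := measurableSet_toMeasurable _ _
  refine ⟨fun s => rewardLaw h0 h1 G (Prod.mk s ⁻¹' E'), measurable_measure_prodMk_left hm',
    fun s => ?_, ?_⟩
  · refine A.expect_wrong_le h0 h1 G s N k fun R S hS hw => subset_toMeasurable _ E ?_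
    rintro ⟨S', hS', hc, hopt⟩
    obtain rfl := Returns.unique A hS hS'
    exact hw ⟨hc, fun a ha => mem_of_isOptimal h0 h1 hm hG (hopt a ha)⟩
  · rw [← Measure.prod_apply hm']
    exact (measure_toMeasurable E).le

theorem lintegral_sampleCount_le (N : ℕ) :
    ∫⁻ s, ∫⁻ R, A.sampleCount N (s, R) ∂(rewardLaw h0 h1 G) ∂(A.seedLaw : Measure A.Seed)
      ≤ A.expectedSamples (twoLevelArms h0 h1 G) := by
  rw [expectedSamples, law, ← lintegral_prod _ (A.measurable_sampleCount N).aemeasurable]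
  exact lintegral_mono fun p => A.sampleCount_le_numSamples N p


end Algorithm

/-! ### Averaging over seeds and numberings -/

namespace Algorithm

open DecisionTree

variable {n : ℕ} (A : Algorithm n) {ε : ℝ} (h0 : 0 < ε) (h1 : ε < 1 / 4)

/-- An inequality that holds for the decision tree of every seed also holds, after integration over
the seed, for the averages over `G` of error probability (`δ`) and expected number of samples
(`B`). -/
theorem le_card_mul_of_sum_le {k m : ℕ} (hm : 1 ≤ m) (N : ℕ)
    {a b c δ B : ℝ} (ha : 0 ≤ a) (hb : 0 ≤ b) (hδ : 0 ≤ δ) (hB : 0 ≤ B)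
    (hE : ∑ G ∈ (Finset.univ : Finset (Fin n)).powersetCard m,
      A.errorProb (twoLevelArms h0 h1 G) k m ε ≤ ENNReal.ofReal δ * (n.choose m : ℝ≥0∞))
    (hT : ∑ G ∈ (Finset.univ : Finset (Fin n)).powersetCard m,
      A.expectedSamples (twoLevelArms h0 h1 G) ≤ ENNReal.ofReal B * (n.choose m : ℝ≥0∞))
    (H : ∀ s : A.Seed, c ≤ ∑ G ∈ (Finset.univ : Finset (Fin n)).powersetCard m,
      (a * (A.tree s N 0 Fin.elim0).expect ε G (fun o _ => wrong k G o) 0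
        + b * ((A.tree s N 0 Fin.elim0).draws ε G
          + (A.tree s N 0 Fin.elim0).expect ε G (fun o _ => cut o) 0))) :
    c ≤ (n.choose m : ℝ) * (a * δ + b * B) := by
  set C := (Finset.univ : Finset (Fin n)).powersetCard m with hC
  have hCc : ∀ G ∈ C, G.card = m := fun G hG => (Finset.mem_powersetCard.1 hG).2
  have hf : ∀ G : C, ∃ f : A.Seed → ℝ≥0∞, Measurable f ∧
      (∀ s, ENNReal.ofReal ((A.tree s N 0 Fin.elim0).expect ε G (fun o _ => wrong k G o) 0)
        ≤ f s) ∧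
      ∫⁻ s, f s ∂(A.seedLaw : Measure A.Seed) ≤ A.errorProb (twoLevelArms h0 h1 G) k m ε :=
    fun G => A.exists_measurable_wrong_le h0 h1 G hm (hCc G G.2) N
  choose f hfm hfw hfE using hf
  set g : Finset (Fin n) → A.Seed → ℝ≥0∞ := fun G s =>
    ∫⁻ R, A.sampleCount N (s, R) ∂(rewardLaw h0 h1 G) with hg
  have hgm : ∀ G, Measurable (g G) := fun G => (A.measurable_sampleCount N).lintegral_prod_right'
  have hpoint : ∀ s, ENNReal.ofReal c
      ≤ ∑ G : C, (ENNReal.ofReal a * f G s + ENNReal.ofReal b * g G s) := by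
    intro s
    refine (ENNReal.ofReal_le_ofReal (H s)).trans ?_
    rw [← Finset.sum_coe_sort C]
    have hX : ∀ G, 0 ≤ (A.tree s N 0 Fin.elim0).draws ε G
        + (A.tree s N 0 Fin.elim0).expect ε G (fun o _ => cut o) 0 := fun G =>
      add_nonneg (draws_nonneg h0 h1 _) (expect_nonneg h0 h1 (fun o _ => cut_nonneg o) _ _)
    have hW : ∀ G, 0 ≤ (A.tree s N 0 Fin.elim0).expect ε G (fun o _ => wrong k G o) 0 :=
      fun G => expect_nonneg h0 h1 (fun o _ => wrong_nonneg k G o) _ _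
    rw [ENNReal.ofReal_sum_of_nonneg fun (G : C) _ =>
      add_nonneg (mul_nonneg ha (hW G)) (mul_nonneg hb (hX G))]
    refine Finset.sum_le_sum fun G _ => ?_
    rw [ENNReal.ofReal_add (mul_nonneg ha (hW G)) (mul_nonneg hb (hX G)),
      ENNReal.ofReal_mul ha, ENNReal.ofReal_mul hb]
    gcongr
    · exact hfw G s
    · exact A.draws_add_cut_le h0 h1 G s N
  have hint : ENNReal.ofReal c ≤ ENNReal.ofReal ((n.choose m : ℝ) * (a * δ + b * B)) := by
    calc ENNReal.ofReal c = ∫⁻ _, ENNReal.ofReal c ∂(A.seedLaw : Measure A.Seed) := by simp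
      _ ≤ ∫⁻ s, ∑ G : C, (ENNReal.ofReal a * f G s + ENNReal.ofReal b * g G s)
            ∂(A.seedLaw : Measure A.Seed) := lintegral_mono hpoint
      _ = ∑ G : C, (ENNReal.ofReal a * ∫⁻ s, f G s ∂(A.seedLaw : Measure A.Seed)
            + ENNReal.ofReal b * ∫⁻ s, g G s ∂(A.seedLaw : Measure A.Seed)) := by
          have hmeas : ∀ G : C, Measurable fun s =>
              ENNReal.ofReal a * f G s + ENNReal.ofReal b * g G s := fun G =>
            ((hfm G).const_mul _).add ((hgm G).const_mul _)
          rw [lintegral_finsetSum _ fun G _ => hmeas G]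
          refine Finset.sum_congr rfl fun G _ => ?_
          rw [lintegral_add_left ((hfm G).const_mul _), lintegral_const_mul _ (hfm G),
            lintegral_const_mul _ (hgm G)]
      _ ≤ ∑ G : C, (ENNReal.ofReal a * A.errorProb (twoLevelArms h0 h1 G) k m ε
            + ENNReal.ofReal b * A.expectedSamples (twoLevelArms h0 h1 G)) := by
          refine Finset.sum_le_sum fun G _ => ?_
          gcongr
          · exact hfE G
          · exact A.lintegral_sampleCount_le h0 h1 G N
      _ = ENNReal.ofReal a * ∑ G ∈ C, A.errorProb (twoLevelArms h0 h1 G) k m ε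
            + ENNReal.ofReal b * ∑ G ∈ C, A.expectedSamples (twoLevelArms h0 h1 G) := by
          rw [Finset.sum_coe_sort C fun G => ENNReal.ofReal a *
              A.errorProb (twoLevelArms h0 h1 G) k m ε
            + ENNReal.ofReal b * A.expectedSamples (twoLevelArms h0 h1 G),
            Finset.sum_add_distrib, Finset.mul_sum, Finset.mul_sum]
      _ ≤ ENNReal.ofReal a * (ENNReal.ofReal δ * (n.choose m : ℝ≥0∞))
            + ENNReal.ofReal b * (ENNReal.ofReal B * (n.choose m : ℝ≥0∞)) := by gcongr
      _ = _ := by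
          rw [ENNReal.ofReal_mul (Nat.cast_nonneg _), ENNReal.ofReal_natCast,
            ENNReal.ofReal_add (mul_nonneg ha hδ) (mul_nonneg hb hB), ENNReal.ofReal_mul ha,
            ENNReal.ofReal_mul hb]
          ring
  exact (ENNReal.ofReal_le_ofReal_iff (by positivity)).1 hint

end Algorithm

theorem exists_perm_map_eq {α : Type*} [Fintype α] [DecidableEq α] {G G' : Finset α}
    (h : G.card = G'.card) : ∃ τ : Equiv.Perm α, G.map τ.toEmbedding = G' := by
  have e : {x // x ∈ G} ≃ {x // x ∈ G'} := Fintype.equivOfCardEq (by simpa using h)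
  refine ⟨e.extendSubtype, Finset.eq_of_subset_of_card_le (fun y hy => ?_) (by simp [h])⟩
  obtain ⟨x, hx, rfl⟩ := Finset.mem_map.1 hy
  exact e.extendSubtype_mem x hx

/-- Averaging over all numberings of the arms is averaging over all positions of the set of good
arms. -/
theorem sum_perm_div_factorial {n m : ℕ} (f : Finset (Fin n) → ℝ≥0∞) {G₀ : Finset (Fin n)}
    (hG₀ : G₀.card = m) :
    (∑ σ : Equiv.Perm (Fin n), f (G₀.map σ.symm.toEmbedding)) / (n.factorial : ℝ≥0∞)
      = (∑ G ∈ (Finset.univ : Finset (Fin n)).powersetCard m, f G) / (n.choose m : ℝ≥0∞) := by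
  set C := (Finset.univ : Finset (Fin n)).powersetCard m with hC
  set p : Equiv.Perm (Fin n) → Finset (Fin n) := fun σ => G₀.map σ.symm.toEmbedding with hp
  have hmaps : ∀ σ ∈ (Finset.univ : Finset (Equiv.Perm (Fin n))), p σ ∈ C := fun σ _ => by
    simp [hp, hC, hG₀]
  set c := (Finset.univ.filter fun σ => p σ = G₀).card with hc
  have hfib : ∀ G ∈ C, (Finset.univ.filter fun σ => p σ = G).card = c := by
    intro G hG
    obtain ⟨τ, hτ⟩ := exists_perm_map_eq (G := G) (G' := G₀)
      (by rw [hG₀, (Finset.mem_powersetCard.1 hG).2])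
    have hpm : ∀ σ : Equiv.Perm (Fin n), p (σ * τ⁻¹) = (p σ).map τ.toEmbedding := by
      intro σ
      simp only [hp, Finset.map_map]
      congr 1
    refine Finset.card_bij (fun σ _ => σ * τ⁻¹) ?_ ?_ ?_
    · intro σ hσ
      rw [Finset.mem_filter] at hσ ⊢
      exact ⟨Finset.mem_univ _, by rw [hpm, hσ.2, hτ]⟩
    · intro σ _ σ' _ h
      exact mul_right_cancel h
    · intro σ hσ
      refine ⟨σ * τ, ?_, by simp⟩
      rw [Finset.mem_filter] at hσ ⊢
      refine ⟨Finset.mem_univ _, Finset.map_injective τ.toEmbedding ?_⟩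
      rw [← hpm, hτ]
      simpa using hσ.2
  have hsum : ∑ σ, f (p σ) = c * ∑ G ∈ C, f G := by
    rw [← Finset.sum_fiberwise_of_maps_to hmaps, Finset.mul_sum]
    refine Finset.sum_congr rfl fun G hG => ?_
    rw [← hfib G hG, ← nsmul_eq_mul, ← Finset.sum_const]
    exact Finset.sum_congr rfl fun σ hσ => by rw [(Finset.mem_filter.1 hσ).2]
  have hcard : n.factorial = c * n.choose m := by
    have h := Finset.card_eq_sum_card_fiberwise hmaps
    rw [Finset.sum_congr rfl hfib, Finset.sum_const, hC, Finset.card_powersetCard,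
      Finset.card_univ, Finset.card_univ, Fintype.card_perm, Fintype.card_fin] at h
    rw [h, smul_eq_mul, mul_comm]
  have hc0 : c ≠ 0 := fun h => by
    rw [h, zero_mul] at hcard
    exact n.factorial_ne_zero hcard
  rw [hsum, hcard, Nat.cast_mul]
  exact ENNReal.mul_div_mul_left _ _ (by exact_mod_cast hc0) (ENNReal.natCast_ne_top c)

namespace Algorithm

open DecisionTree

variable {n : ℕ} (A : Algorithm n) {ε : ℝ} (h0 : 0 < ε) (h1 : ε < 1 / 4)

/-- If an algorithm has average error probability `δ` and takes `B` samples on average, then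
`ε² * B / k` is at least of the order of `log (k / δ)`. -/
theorem confidence_bound {k m : ℕ} (hk : 1 ≤ k) (hkm : k ≤ m) (hmn : 2 * m ≤ n) {δ B : ℝ}
    (hδ : 0 ≤ δ) (hB : 0 < B)
    (hE : ∑ G ∈ (Finset.univ : Finset (Fin n)).powersetCard m,
      A.errorProb (twoLevelArms h0 h1 G) k m ε ≤ ENNReal.ofReal δ * (n.choose m : ℝ≥0∞))
    (hT : ∑ G ∈ (Finset.univ : Finset (Fin n)).powersetCard m,
      A.expectedSamples (twoLevelArms h0 h1 G) ≤ ENNReal.ofReal B * (n.choose m : ℝ≥0∞)) :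
    (k : ℝ) / 4 * Real.exp (-(2 * (240 * ε ^ 2 * B / k + 1))) * (1 / 2 - δ) ≤ δ := by
  set θ := (k : ℝ) / 4 * Real.exp (-(2 * (240 * ε ^ 2 * B / k + 1))) with hθ
  have hk0 : (0 : ℝ) < k := by exact_mod_cast hk
  have hθ0 : 0 < θ := by positivity
  -- this `M` makes the expected potential at most `M / 4`
  set M := 120 * ε ^ 2 * B with hM
  have hM0 : 0 < M := by positivity
  have hθM : θ = (k : ℝ) / 4 * Real.exp (-(2 * (2 * M / k + 1))) := by rw [hθ, hM]; ring_nf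
  -- by Markov's inequality, more than `N` samples are taken with probability at most `1 / 4`
  set N := ⌊4 * B⌋₊ with hN
  have hN4 : 4 * B < N + 1 := Nat.lt_floor_add_one _
  have hN0 : (0 : ℝ) < N + 1 := by positivity
  have hC0 : (0 : ℝ) < n.choose m := by exact_mod_cast Nat.choose_pos (by omega)
  have main := A.le_card_mul_of_sum_le h0 h1 (k := k) (m := m) (by omega) N (a := 1 + θ)
    (b := θ * (1 / (N + 1) + 30 * ε ^ 2 / M)) (c := θ * n.choose m) (by positivity)
    (by positivity) hδ hB.le hE hT ?_
  · have h2 : θ ≤ (1 + θ) * δ + θ * (1 / (N + 1) + 30 * ε ^ 2 / M) * B := by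
      refine le_of_mul_le_mul_left ?_ hC0
      linarith
    have h3 : 1 / (N + 1) * B ≤ 1 / 4 := by
      rw [one_div_mul_eq_div, div_le_iff₀ hN0]; linarith
    have h4 : 30 * ε ^ 2 / M * B = 1 / 4 := by rw [hM]; field_simp; norm_num
    nlinarith
  · intro s
    have h := DecisionTree.confidence_bound h0 h1 hk hkm hmn hM0 (A.tree s N 0 Fin.elim0)
    rw [← hθM] at h
    have hcard : θ * (n.choose m : ℝ)
        = θ * ∑ _G ∈ (Finset.univ : Finset (Fin n)).powersetCard m, (1 : ℝ) := by simp
    rw [hcard]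
    rw [Finset.mul_sum] at h ⊢
    rw [← sub_nonneg, ← Finset.sum_sub_distrib] at h ⊢
    refine h.trans (Finset.sum_le_sum fun G _ => ?_)
    rw [expect_right]
    have hc := A.cut_le_draws_add_cut h0 h1 G s N
    have hc0 : 0 ≤ (A.tree s N 0 Fin.elim0).expect ε G (fun o _ => cut o) 0 :=
      expect_nonneg h0 h1 (fun o _ => cut_nonneg o) _ _
    set w := (A.tree s N 0 Fin.elim0).expect ε G (fun o _ => wrong k G o) 0
    set q := (A.tree s N 0 Fin.elim0).expect ε G (fun o _ => cut o) 0
    set d := (A.tree s N 0 Fin.elim0).draws ε G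
    have hc' : q ≤ 1 / (N + 1) * (d + q) := by
      rw [one_div_mul_eq_div, le_div_iff₀ hN0]; linarith
    have h5 : 0 ≤ 30 * ε ^ 2 / M * q := by positivity
    have h6 := mul_le_mul_of_nonneg_left hc' hθ0.le
    have h7 := mul_nonneg hθ0.le h5
    linarith

/-- If an algorithm has average error probability `δ` and takes `B` samples on average, then
`ε² * B / k` is at least of the order of `n / m`, provided that `n / m` is large. -/
theorem search_bound {k m : ℕ} (hk : 1 ≤ k) (hkm : k ≤ m) (hmn : 2 * m ≤ n) {δ B : ℝ}
    (hδ : 0 ≤ δ) (hB : 0 < B)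
    (hE : ∑ G ∈ (Finset.univ : Finset (Fin n)).powersetCard m,
      A.errorProb (twoLevelArms h0 h1 G) k m ε ≤ ENNReal.ofReal δ * (n.choose m : ℝ≥0∞))
    (hT : ∑ G ∈ (Finset.univ : Finset (Fin n)).powersetCard m,
      A.expectedSamples (twoLevelArms h0 h1 G) ≤ ENNReal.ofReal B * (n.choose m : ℝ≥0∞)) :
    3 / 4 - δ ≤ 2 * m / n * (Real.exp 1 + 192 * ε ^ 2 * B / k) := by
  have hk0 : (0 : ℝ) < k := by exact_mod_cast hk
  have hn0 : (0 : ℝ) < n := by exact_mod_cast (by omega : 0 < n)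
  -- by Markov's inequality, more than `N` samples are taken with probability at most `1 / 4`
  set N := ⌊4 * B⌋₊ with hN
  have hN4 : 4 * B < N + 1 := Nat.lt_floor_add_one _
  have hN4' : (N : ℝ) ≤ 4 * B := Nat.floor_le (by positivity)
  have hN0 : (0 : ℝ) < N + 1 := by positivity
  have hC0 : (0 : ℝ) < n.choose m := by exact_mod_cast Nat.choose_pos (by omega)
  obtain ⟨m', rfl⟩ : ∃ m', m = m' + 1 := ⟨m - 1, by omega⟩
  set X := Real.exp 1 * k + 48 * ε ^ 2 * N with hX
  have hX0 : 0 ≤ X := by positivity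
  have main := A.le_card_mul_of_sum_le h0 h1 (k := k) (m := m' + 1) (by omega) N (a := k)
    (b := k * (1 / (N + 1))) (c := k * n.choose (m' + 1) - n.choose m' * X) (by positivity)
    (by positivity) hδ hB.le hE hT ?_
  · have hch : (n.choose m' : ℝ) ≤ n.choose (m' + 1) * (2 * (m' + 1 : ℕ) / n) := by
      have h := Nat.choose_succ_right_eq n m'
      have h' : (n.choose (m' + 1) : ℝ) * (m' + 1 : ℕ) = n.choose m' * (n - m' : ℕ) := by
        exact_mod_cast h
      have h2 : (n : ℝ) ≤ 2 * (n - m' : ℕ) := by exact_mod_cast (by omega : n ≤ 2 * (n - m'))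
      rw [← mul_div_assoc, le_div_iff₀ hn0, mul_left_comm, h']
      have := mul_le_mul_of_nonneg_left h2 (Nat.cast_nonneg (α := ℝ) (n.choose m'))
      linarith
    have h3 : 1 / (N + 1) * B ≤ 1 / 4 := by
      rw [one_div_mul_eq_div, div_le_iff₀ hN0]; linarith
    have h4 := mul_le_mul_of_nonneg_right hch hX0
    have h5 : (k : ℝ) ≤ 2 * (m' + 1 : ℕ) / n * X + (k * δ + k * (1 / (N + 1)) * B) := by
      refine le_of_mul_le_mul_left ?_ hC0
      linarith
    have h6 : X ≤ k * (Real.exp 1 + 192 * ε ^ 2 * B / k) := by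
      have e : k * (Real.exp 1 + 192 * ε ^ 2 * B / k) = Real.exp 1 * k + 48 * ε ^ 2 * (4 * B) := by
        field_simp; ring
      rw [e, hX]
      gcongr
    have h7 := mul_le_mul_of_nonneg_left h6
      (show (0 : ℝ) ≤ 2 * (m' + 1 : ℕ) / n by positivity)
    have h8 := mul_le_mul_of_nonneg_left h3 hk0.le
    refine le_of_mul_le_mul_left ?_ hk0
    linarith
  · intro s
    have h := DecisionTree.search_bound (m := m') (k := k) h0 h1 (A.tree s N 0 Fin.elim0)
      (A.depth_tree_le s N 0 _)
    rw [← hX] at h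
    have hcard : (k : ℝ) * (n.choose (m' + 1) : ℝ)
        = ∑ _G ∈ (Finset.univ : Finset (Fin n)).powersetCard (m' + 1), (k : ℝ) := by
      simp [mul_comm]
    have h2 : (k : ℝ) * n.choose (m' + 1)
        - k * ∑ G ∈ (Finset.univ : Finset (Fin n)).powersetCard (m' + 1),
          (A.tree s N 0 Fin.elim0).expect ε G (fun o _ => right k G o) 0
        ≤ ∑ G ∈ (Finset.univ : Finset (Fin n)).powersetCard (m' + 1),
      (k * (A.tree s N 0 Fin.elim0).expect ε G (fun o _ => wrong k G o) 0
        + k * (1 / (N + 1)) * ((A.tree s N 0 Fin.elim0).draws ε G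
          + (A.tree s N 0 Fin.elim0).expect ε G (fun o _ => cut o) 0)) := by
      rw [hcard, Finset.mul_sum, ← Finset.sum_sub_distrib]
      refine Finset.sum_le_sum fun G _ => ?_
      rw [expect_right]
      have hc := A.cut_le_draws_add_cut h0 h1 G s N
      set w := (A.tree s N 0 Fin.elim0).expect ε G (fun o _ => wrong k G o) 0
      set q := (A.tree s N 0 Fin.elim0).expect ε G (fun o _ => cut o) 0
      set d := (A.tree s N 0 Fin.elim0).draws ε G
      have hc' : q ≤ 1 / (N + 1) * (d + q) := by
        rw [one_div_mul_eq_div, le_div_iff₀ hN0]; linarith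
      have h6 := mul_le_mul_of_nonneg_left hc' hk0.le
      linarith
    linarith

end Algorithm

end QuantileExploration

end

theorem mainTheorem1 :
    ∃ c : ℝ, 0 < c ∧
      ∀ (n m k : ℕ), 1 ≤ k → k ≤ m → (m : ℝ) ≤ (n : ℝ) / 2 →
      ∀ (ε δ : ℝ), 0 < ε → ε < 1 / 4 → 0 < δ → δ < Real.exp (-8) / 40 →
        ∃ ν : QuantileExploration.ArmSet n,
          ∀ A : QuantileExploration.Algorithm n,
            (∀ σ : Equiv.Perm (Fin n),
              A.errorProb (ν.relabel σ) k m ε ≤ ENNReal.ofReal δ) →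
            ENNReal.ofReal
                (c * ((k : ℝ) / ε ^ 2 * ((n : ℝ) / (m : ℝ) + Real.log ((k : ℝ) / δ)))) ≤
              (∑ σ : Equiv.Perm (Fin n), A.expectedSamples (ν.relabel σ)) /
                (Nat.factorial n : ENNReal) := by
  refine ⟨1 / 10000, by norm_num, fun n m k hk hkm hmn ε δ h0 h1 hδ0 hδ1 => ?_⟩
  have hmn' : 2 * m ≤ n := by
    have : (2 : ℝ) * m ≤ n := by linarith
    exact_mod_cast this
  obtain ⟨G₀, -, hG₀⟩ := Finset.exists_subset_card_eq
    (show m ≤ (Finset.univ : Finset (Fin n)).card by simp; omega)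
  refine ⟨QuantileExploration.twoLevelArms h0 h1 G₀, fun A hA => ?_⟩
  have hk1 : (1 : ℝ) ≤ k := by exact_mod_cast hk
  have hk0 : (0 : ℝ) < k := by linarith
  have hm0 : (0 : ℝ) < m := by exact_mod_cast (by omega : 0 < m)
  have hn0 : (0 : ℝ) < n := by exact_mod_cast (by omega : 0 < n)
  set L := Real.log (k / δ) with hL
  have hkδ : 0 < k / δ := by positivity
  have h8 : Real.exp (-8) * Real.exp 8 = 1 := by rw [← Real.exp_add]; simp
  have he8 : 40 * Real.exp 8 ≤ k / δ := by
    rw [le_div_iff₀ hδ0]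
    have := mul_le_mul_of_nonneg_right hδ1.le (Real.exp_pos 8).le
    nlinarith
  have he3 : Real.exp 3 ≤ 40 := by
    have e : Real.exp 3 = Real.exp 1 ^ 3 := by rw [← Real.exp_nat_mul]; norm_num
    rw [e]
    have := Real.exp_one_lt_d9
    calc Real.exp 1 ^ 3 ≤ 3 ^ 3 := by gcongr; linarith
      _ ≤ 40 := by norm_num
  have hL11 : 11 ≤ L := by
    rw [hL, Real.le_log_iff_exp_le hkδ]
    refine le_trans ?_ he8
    rw [show (11 : ℝ) = 3 + 8 by norm_num, Real.exp_add]
    gcongr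
  have hδs : δ ≤ 1 / 80 := by
    have : Real.exp (-8) ≤ 1 / 2 := by
      have := Real.add_one_le_exp (8 : ℝ)
      nlinarith [Real.exp_pos (-8)]
    linarith
  have hnm : 0 < (n : ℝ) / m := by positivity
  set B := 1 / 10000 * ((k : ℝ) / ε ^ 2 * ((n : ℝ) / m + L)) with hB
  have hB0 : 0 < B := by positivity
  have hεB : ε ^ 2 * B / k = 1 / 10000 * (n / m + L) := by
    rw [hB]; field_simp
  by_contra! hlt
  simp only [QuantileExploration.twoLevelArms_relabel] at hlt hA
  rw [QuantileExploration.sum_perm_div_factorial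
    (fun G => A.expectedSamples (QuantileExploration.twoLevelArms h0 h1 G)) hG₀] at hlt
  have hC0 : (n.choose m : ENNReal) ≠ 0 := by
    exact_mod_cast (Nat.choose_pos (by omega : m ≤ n)).ne'
  have hCt : (n.choose m : ENNReal) ≠ ⊤ := ENNReal.natCast_ne_top _
  have hT := (ENNReal.div_le_iff hC0 hCt).1 hlt.le
  have hE : (∑ G ∈ (Finset.univ : Finset (Fin n)).powersetCard m,
      A.errorProb (QuantileExploration.twoLevelArms h0 h1 G) k m ε)
        ≤ ENNReal.ofReal δ * (n.choose m : ENNReal) := by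
    rw [← ENNReal.div_le_iff hC0 hCt, ← QuantileExploration.sum_perm_div_factorial
      (fun G => A.errorProb (QuantileExploration.twoLevelArms h0 h1 G) k m ε) hG₀,
      ENNReal.div_le_iff (by exact_mod_cast n.factorial_ne_zero) (ENNReal.natCast_ne_top _)]
    refine (Finset.sum_le_sum fun σ _ => hA σ).trans (le_of_eq ?_)
    rw [Finset.sum_const, Finset.card_univ, Fintype.card_perm, Fintype.card_fin, nsmul_eq_mul,
      mul_comm]
  -- the larger of `n / m` and `log (k / δ)` is at least `11`, and alone forces the bound
  rcases le_total L (n / m) with hcase | hcase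
  · have h := A.search_bound h0 h1 hk hkm hmn' hδ0.le hB0 hE hT
    have e : 192 * ε ^ 2 * B / k = 192 * (1 / 10000 * (n / m + L)) := by rw [← hεB]; ring
    rw [e] at h
    set ρ := (n : ℝ) / m with hρ
    have hρ' : 2 * (m : ℝ) / n = 2 / ρ := by rw [hρ]; field_simp
    have h11 : 11 ≤ ρ := hL11.trans hcase
    rw [hρ', div_mul_eq_mul_div, le_div_iff₀ hnm] at h
    have := Real.exp_one_lt_d9
    nlinarith
  · have h := A.confidence_bound h0 h1 hk hkm hmn' hδ0.le hB0 hE hT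
    have e : 240 * ε ^ 2 * B / k = 240 * (1 / 10000 * (n / m + L)) := by rw [← hεB]; ring
    rw [e] at h
    set θ := Real.exp (-(2 * (240 * (1 / 10000 * (n / m + L)) + 1))) with hθ
    have hθ' : Real.exp (-(L / 10 + 2)) ≤ θ := by
      rw [hθ, Real.exp_le_exp]
      linarith
    have hkL : (k : ℝ) = δ * Real.exp L := by
      rw [hL, Real.exp_log hkδ]; field_simp
    have h2 : (k : ℝ) * θ ≤ 16 * δ := by
      have : 0 < (k : ℝ) * θ := by positivity
      nlinarith
    have h3 : Real.exp L * Real.exp (-(L / 10 + 2)) ≤ 16 := by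
      refine le_of_mul_le_mul_left ?_ hδ0
      rw [← mul_assoc, ← hkL]
      have := mul_le_mul_of_nonneg_left hθ' hk0.le
      linarith
    rw [← Real.exp_add] at h3
    have h5 : Real.exp 4 ≤ Real.exp (L + -(L / 10 + 2)) := Real.exp_le_exp.2 (by linarith)
    have h6 : (16 : ℝ) < Real.exp 4 := by
      have e4 : Real.exp 4 = Real.exp 1 ^ 4 := by rw [← Real.exp_nat_mul]; norm_num
      rw [e4]
      have := Real.exp_one_gt_d9
      calc (16 : ℝ) = 2 ^ 4 := by norm_num
        _ < Real.exp 1 ^ 4 := by gcongr; linarith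
    linarith
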